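/- Let $p$ be a prime and let $\Gamma$ be a countable, residually finite discrete group. Let $c_0(\Gamma)$ be the $\mathbb{Q}_p$-algebra of formal series $x=\sum_{\gamma}x_\gamma\gamma$ with $x_\gamma\in\mathbb{Q}_p$ and $|x_\gamma|_p\to 0$ as $\gamma\to\infty$ in $\Gamma$, with the convolution product and the norm $\|x\|=\sup_\gamma|x_\gamma|_p$, and let $A=c_0(\Gamma,\mathbb{Z}_p)$ be its subring of series with coefficients in $\mathbb{Z}_p$. Let $\operatorname{tr}_\Gamma:M_r(c_0(\Gamma))\to\mathbb{Q}_p$ send a matrix to the coefficient at $e$ of its trace, and let $\log_p:\mathbb{Q}_p^*\to\mathbb{Q}_p$ be the branch of the $p$-adic logarithm with $\log_p(p)=0$. For a ring $R$ put $K_1(R)=GL_\infty(R)^{\mathrm{ab}}$ (equivalently $GL_\infty(R)/E_\infty(R)$), and let $Wh^{\mathbb{F}_p}(\Gamma)=K_1(\mathbb{F}_p[\Gamma])/\langle\Gamma\rangle$, where $\langle\Gamma\rangle$ is the image of $\Gamma$. The quantity $\log_p\det_\Gamma f$ is defined in the following cases. (a) For $f\in 1+pM_r(A)$ put $\log_p\det_\Gamma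 f=\operatorname{tr}_\Gamma(\log f)$, where $\log f=-\sum_{\nu\ge1}(1-f)^\nu/\nu$. (b) Suppose that $Wh^{\mathbb{F}_p}(\Gamma)$ is a torsion group. Then there is a unique homomorphism $\log_p\det_\Gamma:K_1(A)\to\mathbb{Q}_p$ which for every $r$ is given on $1+pM_r(A)$ by (a) and which vanishes on the image of $\Gamma$. For $f\in GL_r(A)$ let $\log_p\det_\Gamma f$ be its value at the class of $f$. (c) Suppose that $Wh^{\mathbb{F}_p}(\Gamma)$ is a torsion group and that $\mathbb{F}_p\Gamma$ has no zero divisors. Then there is a unique homomorphism $\log_p\det_\Gamma:c_0(\Gamma)^*\to\mathbb{Q}_p$ which agrees on $A^*$ with the map in (b) (for $r=1$) and satisfies $\log_p\det_\Gamma(p)=0$. This defines $\log_p\det_\Gamma f$ for $f\in c_0(\Gamma)^*$. Let $(\Gamma_n)$ be a sequence of normal subgroups of finite index in $\Gamma$ such that only the neutral element $e$ is contained in infinitely many of the $\Gamma_n$, and put $\Gamma^{(n)}=\Gamma/\Gamma_n$. For $f\in M_r(c_0(\Gamma))$ let $f^{(n)}$ be its image in $M_r(\mathbb{Q}_p\Gamma^{(n)})$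 (the coefficient at a coset is the sum of the coefficients over that coset), and let $\rho_{f^{(n)}}$ be the endomorphism of the $\mathbb{Q}_p$-vector space $(\mathbb{Q}_p\Gamma^{(n)})^r$ given by right multiplication of row vectors by $(f^{(n)})^*$. Here $*$ transposes a matrix and applies $\sum_\delta a_\delta\delta\mapsto\sum_\delta a_\delta\delta^{-1}$ to its entries. Then in each of the cases (a), (b) and (c) (with $r=1$ in case (c)) one has $\det_{\mathbb{Q}_p}(\rho_{f^{(n)}})\neq0$ for all $n$, and $$\log_p\mathrm{det}_\Gamma f=\lim_{n\to\infty}\frac{1}{(\Gamma:\Gamma_n)}\log_p\mathrm{det}_{\mathbb{Q}_p}(\rho_{f^{(n)}}).$$ -/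

import Mathlib

open Filter Topology

/-! ### The `p`-adic convolution algebra `c₀(Γ)` -/

/-- `c₀(Γ)`: formal series `∑ x_γ γ` with coefficients in `ℚ_p` tending to `0` as `γ → ∞`,
i.e. for every `ε > 0` one has `|x_γ|_p < ε` outside a finite subset of `Γ`. -/
@[ext]
structure C0 (p : ℕ) [Fact p.Prime] (Γ : Type*) where
  /-- the coefficient function `γ ↦ x_γ` -/
  coeff : Γ → ℚ_[p]
  /-- the coefficients tend to `0` at infinity -/
  tendsto_zero : Tendsto coeff cofinite (𝓝 0)

namespace C0

section Additive

variable {p : ℕ} [Fact p.Prime] {Γ : Type*}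

theorem coeff_injective : Function.Injective (coeff : C0 p Γ → Γ → ℚ_[p]) :=
  fun _ _ h => C0.ext h

noncomputable instance : Zero (C0 p Γ) := ⟨⟨0, tendsto_const_nhds⟩⟩
noncomputable instance : Add (C0 p Γ) :=
  ⟨fun x y => ⟨x.coeff + y.coeff, by simpa using! x.tendsto_zero.add y.tendsto_zero⟩⟩
noncomputable instance : Neg (C0 p Γ) := ⟨fun x => ⟨-x.coeff, by simpa using! x.tendsto_zero.neg⟩⟩
noncomputable instance : Sub (C0 p Γ) :=
  ⟨fun x y => ⟨x.coeff - y.coeff, by simpa using! x.tendsto_zero.sub y.tendsto_zero⟩⟩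
noncomputable instance : SMul ℚ_[p] (C0 p Γ) :=
  ⟨fun c x => ⟨c • x.coeff, by simpa using! x.tendsto_zero.const_smul c⟩⟩
noncomputable instance : SMul ℕ (C0 p Γ) :=
  ⟨fun c x => ⟨c • x.coeff, by simpa using! x.tendsto_zero.const_smul c⟩⟩
noncomputable instance : SMul ℤ (C0 p Γ) :=
  ⟨fun c x => ⟨c • x.coeff, by simpa using! x.tendsto_zero.const_smul c⟩⟩

@[simp] theorem coeff_zero (γ : Γ) : (0 : C0 p Γ).coeff γ = 0 := rfl
@[simp] theorem coeff_add (x y : C0 p Γ) (γ : Γ) : (x + y).coeff γ = x.coeff γ + y.coeff γ := rfl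
@[simp] theorem coeff_neg (x : C0 p Γ) (γ : Γ) : (-x).coeff γ = -x.coeff γ := rfl
@[simp] theorem coeff_sub (x y : C0 p Γ) (γ : Γ) : (x - y).coeff γ = x.coeff γ - y.coeff γ := rfl
@[simp] theorem coeff_smul (c : ℚ_[p]) (x : C0 p Γ) (γ : Γ) :
    (c • x).coeff γ = c * x.coeff γ := rfl

noncomputable instance : AddCommGroup (C0 p Γ) :=
  coeff_injective.addCommGroup _ rfl (fun _ _ => rfl) (fun _ => rfl) (fun _ _ => rfl)
    (fun _ _ => rfl) (fun _ _ => rfl)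

noncomputable instance : Module ℚ_[p] (C0 p Γ) :=
  coeff_injective.module ℚ_[p] ⟨⟨coeff, rfl⟩, fun _ _ => rfl⟩ (fun _ _ => rfl)

theorem bddAbove_norm (x : C0 p Γ) : BddAbove (Set.range fun γ => ‖x.coeff γ‖) := by
  have h := (x.tendsto_zero.norm).isBoundedUnder_le
  obtain ⟨b, hb⟩ := h
  have hfin : {γ | ¬ ‖x.coeff γ‖ ≤ b}.Finite := by simpa [Filter.mem_cofinite] using! hb
  obtain ⟨M, hM⟩ := (hfin.image fun γ => ‖x.coeff γ‖).bddAbove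
  refine ⟨max b M, ?_⟩
  rintro _ ⟨γ, rfl⟩
  by_cases hγ : ‖x.coeff γ‖ ≤ b
  · exact le_max_of_le_left hγ
  · exact le_max_of_le_right (hM ⟨γ, hγ, rfl⟩)

/-- `c₀(Γ)` with the supremum norm `‖∑ x_γ γ‖ = sup_γ |x_γ|_p`. -/
noncomputable instance : NormedAddCommGroup (C0 p Γ) :=
  AddGroupNorm.toNormedAddCommGroup
    { toFun := fun x => ⨆ γ, ‖x.coeff γ‖
      map_zero' := by simp
      add_le' := fun x y => Real.iSup_le
        (fun γ => (norm_add_le _ _).trans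
          (add_le_add (le_ciSup x.bddAbove_norm γ) (le_ciSup y.bddAbove_norm γ)))
        (add_nonneg (Real.iSup_nonneg fun _ => norm_nonneg _)
          (Real.iSup_nonneg fun _ => norm_nonneg _))
      neg' := fun x => by simp
      eq_zero_of_map_eq_zero' := fun x hx => by
        ext γ
        have h1 := le_ciSup x.bddAbove_norm γ
        rw [hx] at h1
        simpa using h1 }

theorem norm_def (x : C0 p Γ) : ‖x‖ = ⨆ γ, ‖x.coeff γ‖ := rfl

theorem norm_coeff_le (x : C0 p Γ) (γ : Γ) : ‖x.coeff γ‖ ≤ ‖x‖ := le_ciSup x.bddAbove_norm γ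

theorem summable_coeff (x : C0 p Γ) : Summable x.coeff :=
  NonarchimedeanAddGroup.summable_of_tendsto_cofinite_zero x.tendsto_zero

end Additive

section Ring

variable {p : ℕ} [Fact p.Prime] {Γ : Type*} [Group Γ]

/-- The triangular change of variables `(a, b) ↦ (a, a⁻¹ b)`. -/
def shear (Γ : Type*) [Group Γ] : Γ × Γ ≃ Γ × Γ where
  toFun q := (q.1, q.1⁻¹ * q.2)
  invFun q := (q.1, q.1 * q.2)
  left_inv q := by simp
  right_inv q := by simp

theorem summable_pair (x y : C0 p Γ) :
    Summable fun q : Γ × Γ => x.coeff q.1 * y.coeff (q.1⁻¹ * q.2) :=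
  haveI : NonarchimedeanRing ℚ_[p] := ⟨NonarchimedeanAddGroup.is_nonarchimedean⟩
  (shear Γ).summable_iff.mpr (x.summable_coeff.mul_of_nonarchimedean y.summable_coeff)

theorem summable_conv (x y : C0 p Γ) (γ : Γ) :
    Summable fun a : Γ => x.coeff a * y.coeff (a⁻¹ * γ) :=
  (summable_pair x y).comp_injective (i := fun a : Γ => (a, γ)) fun _ _ h => (Prod.mk.inj h).1

/-- The convolution product `(∑ x_γ γ)(∑ y_γ γ) = ∑_γ (∑_{γ'} x_{γ'} y_{γ'⁻¹ γ}) γ`. -/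
noncomputable instance : Mul (C0 p Γ) where
  mul x y :=
    { coeff := fun γ => ∑' a : Γ, x.coeff a * y.coeff (a⁻¹ * γ)
      tendsto_zero := by
        have h := (summable_pair x y).tendsto_cofinite_zero
        rw [Metric.tendsto_nhds] at h ⊢
        intro ε hε
        have hfin := h (ε / 2) (half_pos hε)
        rw [Filter.eventually_cofinite] at hfin ⊢
        refine (hfin.image Prod.snd).subset fun γ hγ => ?_
        by_contra hcon
        apply hγ
        rw [dist_zero_right]
        refine lt_of_le_of_lt ?_ (half_lt_self hε)
        refine IsUltrametricDist.norm_tsum_le_of_forall_le_of_nonneg (half_pos hε).le fun a => ?_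
        by_contra ha
        exact hcon ⟨(a, γ), by
          simp only [Set.mem_ofPred_eq, dist_zero_right, not_lt]
          exact (not_le.mp ha).le, rfl⟩ }

theorem coeff_mul (x y : C0 p Γ) (γ : Γ) :
    (x * y).coeff γ = ∑' a : Γ, x.coeff a * y.coeff (a⁻¹ * γ) := rfl

open Classical in
/-- The element `γ` of `Γ`, viewed in `c₀(Γ)`. -/
noncomputable def delta (p : ℕ) [Fact p.Prime] {Γ : Type*} (γ : Γ) : C0 p Γ where
  coeff := fun a => if a = γ then 1 else 0
  tendsto_zero := by
    refine tendsto_nhds_of_eventually_eq ?_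
    rw [Filter.eventually_cofinite]
    refine (Set.finite_singleton γ).subset fun a ha => ?_
    by_contra h
    exact ha (if_neg h)

theorem delta_self {Γ : Type*} (γ : Γ) : (delta p γ).coeff γ = 1 := if_pos rfl

theorem delta_ne {Γ : Type*} {γ a : Γ} (h : a ≠ γ) : (delta p γ).coeff a = 0 := if_neg h

theorem norm_delta_le {Γ : Type*} (γ a : Γ) : ‖(delta p γ).coeff a‖ ≤ 1 := by
  by_cases h : a = γ
  · simp [h, delta_self]
  · simp [delta_ne h]

noncomputable instance : One (C0 p Γ) := ⟨delta p 1⟩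

theorem delta_mul_coeff (g : Γ) (x : C0 p Γ) (γ : Γ) :
    (delta p g * x).coeff γ = x.coeff (g⁻¹ * γ) := by
  rw [coeff_mul, tsum_eq_single g]
  · simp [delta_self]
  · intro b hb
    simp [delta_ne hb]

theorem mul_delta_coeff (g : Γ) (x : C0 p Γ) (γ : Γ) :
    (x * delta p g).coeff γ = x.coeff (γ * g⁻¹) := by
  rw [coeff_mul, tsum_eq_single (γ * g⁻¹)]
  · simp [delta_self]
  · intro b hb
    have : b⁻¹ * γ ≠ g := fun h => hb (by rw [← h]; group)
    simp [delta_ne this]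

theorem conv_assoc (x y z : C0 p Γ) : x * y * z = x * (y * z) := by
  ext γ
  have hs : Summable fun q : Γ × Γ =>
      x.coeff q.1 * y.coeff (q.1⁻¹ * q.2) * z.coeff (q.2⁻¹ * γ) := by
    apply NonarchimedeanAddGroup.summable_of_tendsto_cofinite_zero
    have h := (summable_pair x y).tendsto_cofinite_zero
    refine squeeze_zero_norm (a := fun q : Γ × Γ =>
      ‖x.coeff q.1 * y.coeff (q.1⁻¹ * q.2)‖ * ‖z‖) (fun q => ?_) ?_
    · rw [norm_mul]
      exact mul_le_mul_of_nonneg_left (norm_coeff_le z _) (norm_nonneg _)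
    · simpa using h.norm.mul_const ‖z‖
  have hl : (x * y * z).coeff γ = ∑' b : Γ, ∑' a : Γ,
      x.coeff a * y.coeff (a⁻¹ * b) * z.coeff (b⁻¹ * γ) := by
    rw [coeff_mul]
    exact tsum_congr fun b => by rw [coeff_mul, tsum_mul_right]
  have hr : (x * (y * z)).coeff γ = ∑' a : Γ, ∑' b : Γ,
      x.coeff a * y.coeff (a⁻¹ * b) * z.coeff (b⁻¹ * γ) := by
    rw [coeff_mul]
    refine tsum_congr fun a => ?_
    rw [coeff_mul, ← tsum_mul_left, ← (Equiv.mulLeft a⁻¹).tsum_eq]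
    refine tsum_congr fun b => ?_
    simp [mul_assoc]
  rw [hl, hr]
  exact Summable.tsum_comm (f := fun a b =>
    x.coeff a * y.coeff (a⁻¹ * b) * z.coeff (b⁻¹ * γ)) hs

noncomputable instance : Ring (C0 p Γ) where
  __ := (inferInstance : AddCommGroup (C0 p Γ))
  mul_assoc := conv_assoc
  one_mul x := by ext γ; exact (delta_mul_coeff 1 x γ).trans (by simp)
  mul_one x := by ext γ; exact (mul_delta_coeff 1 x γ).trans (by simp)
  zero_mul x := by ext γ; simp [coeff_mul]
  mul_zero x := by ext γ; simp [coeff_mul]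
  left_distrib x y z := by
    ext γ
    simp only [coeff_mul, coeff_add, mul_add]
    exact (summable_conv x y γ).tsum_add (summable_conv x z γ)
  right_distrib x y z := by
    ext γ
    simp only [coeff_mul, coeff_add, add_mul]
    exact (summable_conv x z γ).tsum_add (summable_conv y z γ)

noncomputable instance : Algebra ℚ_[p] (C0 p Γ) :=
  Algebra.ofModule
    (fun c x y => by ext γ; simp only [coeff_mul, coeff_smul, mul_assoc, tsum_mul_left])
    (fun c x y => by
      ext γ
      simp only [coeff_mul, coeff_smul, mul_left_comm _ c, tsum_mul_left])

/-- The inclusion of `Γ` into the multiplicative monoid of `c₀(Γ)`. -/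
noncomputable def of (p : ℕ) [Fact p.Prime] (Γ : Type*) [Group Γ] : Γ →* C0 p Γ where
  toFun := delta p
  map_one' := rfl
  map_mul' a b := by
    ext γ
    rw [delta_mul_coeff]
    by_cases h : γ = a * b
    · simp [h, delta_self]
    · have h' : a⁻¹ * γ ≠ b := fun hb => h (by rw [← hb]; group)
      simp [delta_ne h, delta_ne h']

/-- The subring `c₀(Γ, ℤ_p)` of series with coefficients in `ℤ_p`, i.e. with all `|x_γ|_p ≤ 1`. -/
noncomputable def integral (p : ℕ) [Fact p.Prime] (Γ : Type*) [Group Γ] : Subring (C0 p Γ) where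
  carrier := {x | ∀ γ, ‖x.coeff γ‖ ≤ 1}
  zero_mem' γ := by simp
  one_mem' γ := norm_delta_le 1 γ
  add_mem' {x y} hx hy γ :=
    (IsUltrametricDist.norm_add_le_max _ _).trans (max_le (hx γ) (hy γ))
  neg_mem' {x} hx γ := by simpa using hx γ
  mul_mem' {x y} hx hy γ := by
    refine IsUltrametricDist.norm_tsum_le_of_forall_le_of_nonneg zero_le_one fun a => ?_
    rw [norm_mul]
    exact mul_le_one₀ (hx _) (norm_nonneg _) (hy _)

/-- The inclusion of `Γ` into the multiplicative monoid of `c₀(Γ, ℤ_p)`. -/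
noncomputable def integralOf (p : ℕ) [Fact p.Prime] (Γ : Type*) [Group Γ] : Γ →* integral p Γ :=
  (of p Γ).codRestrict (integral p Γ) norm_delta_le

/-- The image in `ℚ_p[Γ/N]` of an element of `c₀(Γ)`, for `N` normal of finite index: the
coefficient at a coset `δ` is the (convergent) sum `∑_{γ ∈ δ} a_γ`. -/
noncomputable def reduce (N : Subgroup Γ) [N.Normal] [N.FiniteIndex] (x : C0 p Γ) :
    MonoidAlgebra ℚ_[p] (Γ ⧸ N) :=
  .ofCoeff (Finsupp.equivFunOnFinite.symm fun δ : Γ ⧸ N =>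
    ∑' γ : {γ : Γ // (γ : Γ ⧸ N) = δ}, x.coeff γ)

end Ring

end C0

/-! ### Logarithms and the determinant on `1`-units -/

/-- The logarithmic series `log u = - ∑_{ν ≥ 1} (1 - u)^ν / ν` in a topological `ℚ_p`-algebra. -/
noncomputable def logSeries (p : ℕ) [Fact p.Prime] {B : Type*} [Ring B] [Module ℚ_[p] B]
    [TopologicalSpace B] (u : B) : B :=
  -∑' ν : ℕ, ((ν : ℚ_[p]) + 1)⁻¹ • (1 - u) ^ (ν + 1)

/-- The branch `log_p : ℚ_pˣ → ℚ_p` of the `p`-adic logarithm with `log_p p = 0`. Writing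
`x = p ^ v(x) * u` with `u` a unit of `ℤ_p`, the power `u ^ (p - 1)` is a `1`-unit, and
`log_p x = log (u ^ (p - 1)) / (p - 1)`. The value at `x = 0` is meaningless. -/
noncomputable def padicLog {p : ℕ} [Fact p.Prime] (x : ℚ_[p]) : ℚ_[p] :=
  ((p : ℚ_[p]) - 1)⁻¹ * logSeries p ((x * (p : ℚ_[p]) ^ (-x.valuation)) ^ (p - 1))

/-- `f ∈ 1 + p M_r(c₀(Γ, ℤ_p))`. -/
def IsOneUnit {p : ℕ} [Fact p.Prime] {Γ : Type*} [Group Γ] {r : ℕ}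
    (f : Matrix (Fin r) (Fin r) (C0 p Γ)) : Prop :=
  ∃ a : Matrix (Fin r) (Fin r) (C0.integral p Γ),
    f = 1 + (p : ℚ_[p]) • a.map (C0.integral p Γ).subtype

/-- The trace functional `tr_Γ` on `M_r(c₀(Γ))`: the coefficient at `e` of the matrix trace. -/
noncomputable def traceΓ {p : ℕ} [Fact p.Prime] {Γ : Type*} [Group Γ] {r : ℕ}
    (f : Matrix (Fin r) (Fin r) (C0 p Γ)) : ℚ_[p] :=
  (Matrix.trace f).coeff 1

/-- `log_p det_Γ f = tr_Γ (log f)` for `f` in `1 + p M_r(c₀(Γ, ℤ_p))`. The series is taken in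
`M_r(c₀(Γ))` with the topology of the norm `max_{ij} ‖f_ij‖`. -/
noncomputable def logDetOneUnit {p : ℕ} [Fact p.Prime] {Γ : Type*} [Group Γ] {r : ℕ}
    (f : Matrix (Fin r) (Fin r) (C0 p Γ)) : ℚ_[p] :=
  traceΓ (logSeries p f)

/-! ### The group `K₁` and the Whitehead group over `𝔽_p` -/

section K1

variable (R : Type*) [Ring R]

/-- The matrix `diag(a, 1)` of size `s` for a matrix `a` of size `r ≤ s`. -/
def stabMatrix {R : Type*} [Ring R] (r s : ℕ) (a : Matrix (Fin r) (Fin r) R) :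
    Matrix (Fin s) (Fin s) R :=
  Matrix.of fun i j =>
    if h : (i : ℕ) < r ∧ (j : ℕ) < r then a ⟨i, h.1⟩ ⟨j, h.2⟩ else if i = j then 1 else 0

theorem stabMatrix_one {R : Type*} [Ring R] (r s : ℕ) :
    stabMatrix r s (1 : Matrix (Fin r) (Fin r) R) = 1 := by
  ext i j
  simp only [stabMatrix, Matrix.of_apply, Matrix.one_apply, Fin.ext_iff]
  split_ifs <;> rfl

theorem stabMatrix_mul {R : Type*} [Ring R] {r s : ℕ} (h : r ≤ s)
    (a b : Matrix (Fin r) (Fin r) R) :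
    stabMatrix r s (a * b) = stabMatrix r s a * stabMatrix r s b := by
  obtain ⟨t, rfl⟩ := Nat.exists_eq_add_of_le h
  have e11 : ∀ (c : Matrix (Fin r) (Fin r) R) (i j : Fin r),
      stabMatrix r (r + t) c (Fin.castAdd t i) (Fin.castAdd t j) = c i j := fun c i j => by
    simp [stabMatrix]
  have e12 : ∀ (c : Matrix (Fin r) (Fin r) R) (i : Fin r) (j : Fin t),
      stabMatrix r (r + t) c (Fin.castAdd t i) (Fin.natAdd r j) = 0 := fun c i j => by
    have : ¬ (i : ℕ) = r + j := by omega
    simp [stabMatrix, Fin.ext_iff, this]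
  have e21 : ∀ (c : Matrix (Fin r) (Fin r) R) (i : Fin t) (j : Fin r),
      stabMatrix r (r + t) c (Fin.natAdd r i) (Fin.castAdd t j) = 0 := fun c i j => by
    have : ¬ r + (i : ℕ) = j := by omega
    simp [stabMatrix, Fin.ext_iff, this]
  have e22 : ∀ (c : Matrix (Fin r) (Fin r) R) (i j : Fin t),
      stabMatrix r (r + t) c (Fin.natAdd r i) (Fin.natAdd r j) = if i = j then 1 else 0 :=
    fun c i j => by simp [stabMatrix, Fin.ext_iff]
  ext i j
  rw [Matrix.mul_apply, Fin.sum_univ_add]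
  refine Fin.addCases (fun i => ?_) (fun i => ?_) i <;>
    refine Fin.addCases (fun j => ?_) (fun j => ?_) j <;>
    simp [e11, e12, e21, e22, Matrix.mul_apply]

theorem stabMatrix_self {R : Type*} [Ring R] (r : ℕ) (a : Matrix (Fin r) (Fin r) R) :
    stabMatrix r r a = a := by
  ext i j
  simp [stabMatrix]

theorem stabMatrix_stabMatrix {R : Type*} [Ring R] {r s t : ℕ} (hrs : r ≤ s) (_ : s ≤ t)
    (a : Matrix (Fin r) (Fin r) R) : stabMatrix s t (stabMatrix r s a) = stabMatrix r t a := by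
  ext i j
  simp only [stabMatrix, Matrix.of_apply, Fin.ext_iff]
  split_ifs <;> first | rfl | omega

/-- The embedding `GL_r(R) → GL_s(R)`, `a ↦ diag(a, 1)`, for `r ≤ s`. -/
def stabGL {r s : ℕ} (h : r ≤ s) : (Matrix (Fin r) (Fin r) R)ˣ →* (Matrix (Fin s) (Fin s) R)ˣ :=
  Units.map
    { toFun := stabMatrix r s
      map_one' := stabMatrix_one r s
      map_mul' := stabMatrix_mul h }

instance : DirectedSystem (fun r : ℕ => (Matrix (Fin r) (Fin r) R)ˣ)
    (fun _ _ h => stabGL R h) where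
  map_self _ _ := Units.ext (stabMatrix_self _ _)
  map_map _ _ _ hij hjk _ := Units.ext (stabMatrix_stabMatrix hij hjk _)

/-- `GL_∞(R)`, the union of the groups `GL_r(R)` along the embeddings `a ↦ diag(a, 1)`. -/
abbrev GLInf : Type _ :=
  DirectLimit (fun r : ℕ => (Matrix (Fin r) (Fin r) R)ˣ) (fun _ _ h => stabGL R h)

/-- The embedding `GL_r(R) → GL_∞(R)`. -/
noncomputable def toGLInf (r : ℕ) : (Matrix (Fin r) (Fin r) R)ˣ →* GLInf R where
  toFun a := ⟦⟨r, a⟩⟧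
  map_one' := (DirectLimit.one_def r).symm
  map_mul' a b := (DirectLimit.mul_def (f := fun _ _ h => stabGL R h) r a b).symm

/-- `K₁(R) = GL_∞(R)^{ab}`, the quotient of `GL_∞(R)` by its commutator subgroup (which is the
subgroup `E_∞(R)` generated by the elementary matrices, by Whitehead's lemma). -/
abbrev K1 : Type _ := Abelianization (GLInf R)

/-- The canonical map `GL_r(R) → K₁(R)`. -/
noncomputable def toK1 (r : ℕ) : (Matrix (Fin r) (Fin r) R)ˣ →* K1 R :=
  Abelianization.of.comp (toGLInf R r)

/-- The canonical map `Rˣ = GL_1(R) → K₁(R)`. -/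
noncomputable def unitsToK1 : Rˣ →* K1 R :=
  (toK1 R 1).comp (Units.map (Matrix.scalar (Fin 1)).toMonoidHom)

end K1

/-- The Whitehead group `Wh^F(Γ) = K₁(F[Γ]) / ⟨Γ⟩` over `F`, where `⟨Γ⟩` is the image of `Γ`
under `Γ → F[Γ]ˣ → K₁(F[Γ])`. -/
abbrev WhiteheadGroup (F : Type*) [Ring F] (Γ : Type*) [Group Γ] : Type _ :=
  K1 (MonoidAlgebra F Γ) ⧸
    ((unitsToK1 (MonoidAlgebra F Γ)).comp (MonoidAlgebra.of F Γ).toHomUnits).range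

/-! ### The extensions of `log_p det_Γ` -/

section LogDet

variable (p : ℕ) [Fact p.Prime] (Γ : Type*) [Group Γ]

/-- The matrix over `c₀(Γ)` underlying an element of `GL_r(c₀(Γ, ℤ_p))`. -/
noncomputable def glVal {p : ℕ} [Fact p.Prime] {Γ : Type*} [Group Γ] {r : ℕ}
    (f : (Matrix (Fin r) (Fin r) (C0.integral p Γ))ˣ) : Matrix (Fin r) (Fin r) (C0 p Γ) :=
  f.val.map (C0.integral p Γ).subtype

/-- `L` is the map `log_p det_Γ` on `K₁(c₀(Γ, ℤ_p))`: a homomorphism to the additive group of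
`ℚ_p` which on `1`-units is given by `tr_Γ log` and which vanishes on the image of `Γ`. -/
structure IsLogDetK1 (L : K1 (C0.integral p Γ) →* Multiplicative ℚ_[p]) : Prop where
  oneUnit : ∀ (r : ℕ) (u : (Matrix (Fin r) (Fin r) (C0.integral p Γ))ˣ), IsOneUnit (glVal u) →
    (L (toK1 _ r u)).toAdd = logDetOneUnit (glVal u)
  group : ∀ γ : Γ, (L (unitsToK1 _ ((C0.integralOf p Γ).toHomUnits γ))).toAdd = 0

/-- `log_p det_Γ` on `GL_r(c₀(Γ, ℤ_p))`, given `log_p det_Γ` on `K₁(c₀(Γ, ℤ_p))`. -/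
noncomputable def logDetGL {p : ℕ} [Fact p.Prime] {Γ : Type*} [Group Γ]
    (L : K1 (C0.integral p Γ) →* Multiplicative ℚ_[p]) {r : ℕ}
    (f : (Matrix (Fin r) (Fin r) (C0.integral p Γ))ˣ) : ℚ_[p] :=
  (L (toK1 _ r f)).toAdd

/-- `D` is the map `log_p det_Γ` on `c₀(Γ)ˣ`: a homomorphism to the additive group of `ℚ_p`
which agrees with `L` on `c₀(Γ, ℤ_p)ˣ` and vanishes on the element `p`. -/
structure IsLogDetUnits (L : K1 (C0.integral p Γ) →* Multiplicative ℚ_[p])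
    (D : (C0 p Γ)ˣ →* Multiplicative ℚ_[p]) : Prop where
  integral : ∀ u : (C0.integral p Γ)ˣ,
    D (Units.map (C0.integral p Γ).subtype.toMonoidHom u) = L (unitsToK1 _ u)
  prime : ∀ u : (C0 p Γ)ˣ, (u : C0 p Γ) = (p : C0 p Γ) → (D u).toAdd = 0

end LogDet

/-! ### Finite quotients -/

/-- The endomorphism `ρ_f` of the `ℚ_p`-vector space `(ℚ_p G)^r`: right multiplication of row
vectors by `f^*`, where `(f^*)_{ij}` is the image of `f_{ji}` under `∑ a_g g ↦ ∑ a_g g⁻¹`. -/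
noncomputable def rho {p : ℕ} [Fact p.Prime] {G : Type*} [Group G] {r : ℕ}
    (f : Matrix (Fin r) (Fin r) (MonoidAlgebra ℚ_[p] G)) :
    (Fin r → MonoidAlgebra ℚ_[p] G) →ₗ[ℚ_[p]] (Fin r → MonoidAlgebra ℚ_[p] G) :=
  (Matrix.vecMulLinear
    (f.transpose.map (MonoidAlgebra.mapDomain fun g => g⁻¹))).restrictScalars ℚ_[p]

/-- `det_{ℚ_p}(ρ_{f̃})`, where `f̃` is the image of `f ∈ M_r(c₀(Γ))` in `M_r(ℚ_p[Γ/N])`. -/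
noncomputable def detRho {p : ℕ} [Fact p.Prime] {Γ : Type*} [Group Γ] {r : ℕ}
    (N : Subgroup Γ) [N.Normal] [N.FiniteIndex] (f : Matrix (Fin r) (Fin r) (C0 p Γ)) : ℚ_[p] :=
  LinearMap.det (rho (f.map (C0.reduce N)))

/-- `x = lim_{n → ∞} (Γ : Γ_n)⁻¹ log_p det_{ℚ_p}(ρ_{f^{(n)}})`, where moreover all the
determinants are non-zero, so that their `p`-adic logarithms are defined. -/
def IsLogDetLimit {p : ℕ} [Fact p.Prime] {Γ : Type*} [Group Γ] {r : ℕ}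
    (S : ℕ → Subgroup Γ) [∀ n, (S n).Normal] [∀ n, (S n).FiniteIndex]
    (f : Matrix (Fin r) (Fin r) (C0 p Γ)) (x : ℚ_[p]) : Prop :=
  (∀ n, detRho (S n) f ≠ 0) ∧
    Tendsto (fun n => ((S n).index : ℚ_[p])⁻¹ * padicLog (detRho (S n) f)) atTop (𝓝 x)

/-! ### The `p`-adic logarithm as a limit of divided powers -/

section PadicLogarithm

variable {p : ℕ} [hp : Fact p.Prime]

/-! Everything rests on one exact identity at finite level. For `f = 1 + p a` with `a` integral,
`ρ_{f^(n)}` has the matrix `1 + p X` with `X` over `ℤ_p`, and `log det (1 + p X) = tr log (1 + p X)`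
(`padicLog_det_one_add_smul`). A diagonal entry of the regular representation is the coefficient at
the neutral coset, so the trace is the index times the sum over `Γ_n` of the coefficients of `tr
(log f)`. Thus the normalized logarithm equals that coset sum (`padicLog_detRho_oneUnit`). A null
family has finitely many non-small coefficients, and each element other than `e` leaves the `Γ_n`
eventually, so the coset sums converge to the coefficient at `e`. This settles (a).

For (b), all normalized logarithms together form one homomorphism from `GL_∞(A)` to sequences in
`ℚ_p`. The elements at which it converges form a subgroup closed under roots, containing the
`1`-units, the commutators and `Γ` (where the sequence vanishes). Reduction mod `p` maps `GL_∞(A)`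
onto `GL_∞(𝔽_p[Γ])`, and kernel elements are represented by `1`-units, so torsion of the Whitehead
group forces such a subgroup to be everything (`mem_of_isMulTorsion_whiteheadGroup`). Hence the
limit exists everywhere and is itself the required homomorphism; no multiplicativity of `tr_Γ log`
has to be proved separately. The same lemma applied to an equalizer gives uniqueness.

For (c), absence of zero divisors mod `p` gives `c₀(Γ)ˣ = p^ℤ · Aˣ`
(`C0.exists_primeUnit_zpow_mul`), and the sequence vanishes at `p`, so the same argument applies. -/

theorem Padic.norm_natCast_le (n : ℕ) : ‖(n : ℚ_[p])‖ ≤ 1 := by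
  have := (n : ℤ_[p]).norm_le_one
  rwa [PadicInt.norm_def, PadicInt.coe_natCast] at this

/-- The power of `p` dividing `n + 1` is at most `n + 1`. This linear growth is beaten by `p ^ (-(n
+ 1))`, which makes the logarithm converge on `1 + p ℤ_p` for every `p`, including `2`. -/
theorem Padic.norm_natCast_succ_inv_le (n : ℕ) : ‖((n : ℚ_[p]) + 1)⁻¹‖ ≤ (n : ℝ) + 1 := by
  have h0 : ((n + 1 : ℕ) : ℚ_[p]) ≠ 0 := Nat.cast_ne_zero.mpr n.succ_ne_zero
  have h1 := Padic.norm_eq_zpow_neg_valuation h0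
  rw [Padic.valuation_natCast] at h1
  rw [norm_inv, ← Nat.cast_succ, h1, zpow_neg, inv_inv, zpow_natCast]
  have h2 : p ^ padicValNat p (n + 1) ≤ n + 1 := Nat.le_of_dvd n.succ_pos pow_padicValNat_dvd
  exact_mod_cast h2

theorem Padic.summable_succ_mul_pow :
    Summable fun n : ℕ => ((n : ℝ) + 1) * ((p : ℝ)⁻¹) ^ (n + 1) := by
  have h1 : ‖((p : ℝ)⁻¹)‖ < 1 := by
    rw [norm_inv, Real.norm_natCast]
    exact inv_lt_one_of_one_lt₀ (by exact_mod_cast hp.out.one_lt)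
  have := (summable_nat_add_iff 1).mpr (summable_pow_mul_geometric_of_norm_lt_one (R := ℝ) 1 h1)
  simpa using this

theorem Padic.norm_p_pow_eq (n : ℕ) : ‖(p : ℚ_[p]) ^ n‖ = ((p : ℝ)⁻¹) ^ n := by
  rw [norm_pow, Padic.norm_p]

/-- The coefficient of `a ^ (ν + 1)` in the expansion of `log (1 + p a)`. -/
noncomputable def logCoeff (p : ℕ) [Fact p.Prime] (ν : ℕ) : ℚ_[p] :=
  (-1) ^ ν * ((ν : ℚ_[p]) + 1)⁻¹ * (p : ℚ_[p]) ^ (ν + 1)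

theorem norm_logCoeff_le (ν : ℕ) : ‖logCoeff p ν‖ ≤ ((ν : ℝ) + 1) * ((p : ℝ)⁻¹) ^ (ν + 1) := by
  rw [logCoeff, norm_mul, norm_mul, Padic.norm_p_pow_eq]
  simp only [norm_pow, norm_neg, norm_one, one_pow, one_mul]
  gcongr
  exact Padic.norm_natCast_succ_inv_le ν

theorem tendsto_logCoeff : Tendsto (logCoeff p) atTop (𝓝 0) :=
  squeeze_zero_norm norm_logCoeff_le Padic.summable_succ_mul_pow.tendsto_atTop_zero

/-- With `m + 1 = p ^ k` this trades division by `p ^ k`, unbounded in `k`, for division by `ν + 1`,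
which does not depend on `k`. -/
theorem choose_div_eq (m ν : ℕ) :
    ((m : ℚ_[p]) + 1)⁻¹ * ((m + 1).choose (ν + 1) : ℚ_[p]) =
      (m.choose ν : ℚ_[p]) * ((ν : ℚ_[p]) + 1)⁻¹ := by
  have h1 : (m : ℚ_[p]) + 1 ≠ 0 := by exact_mod_cast m.succ_ne_zero
  have h2 : (ν : ℚ_[p]) + 1 ≠ 0 := by exact_mod_cast ν.succ_ne_zero
  have h3 : ((m : ℚ_[p]) + 1) * m.choose ν = (m + 1).choose (ν + 1) * (ν + 1) := by
    exact_mod_cast Nat.add_one_mul_choose_eq m ν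
  field_simp
  linear_combination -h3

theorem cast_prime_pow_sub_one (k : ℕ) :
    ((p ^ k - 1 : ℕ) : ℚ_[p]) + 1 = (p : ℚ_[p]) ^ k := by
  have : p ^ k - 1 + 1 = p ^ k := Nat.sub_add_cancel (Nat.one_le_pow _ _ hp.out.pos)
  exact_mod_cast congrArg (Nat.cast (R := ℚ_[p])) this

theorem tendsto_prime_pow : Tendsto (fun k : ℕ => (p : ℚ_[p]) ^ k) atTop (𝓝 0) :=
  tendsto_pow_atTop_nhds_zero_of_norm_lt_one Padic.norm_p_lt_one

/-- Since `p ^ k → 0`, the limit is the binomial coefficient of `-1` over `ν`. The induction uses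
Pascal's rule, whose left side `choose (p ^ k) (ν + 1)` is a multiple of `p ^ k / (ν + 1)`. -/
theorem tendsto_choose_prime_pow_sub_one (ν : ℕ) :
    Tendsto (fun k : ℕ => ((p ^ k - 1).choose ν : ℚ_[p])) atTop (𝓝 ((-1) ^ ν)) := by
  induction ν with
  | zero => simp
  | succ ν ih =>
    have h1 : ∀ k : ℕ, ((p ^ k - 1).choose (ν + 1) : ℚ_[p]) =
        (p : ℚ_[p]) ^ k * (((p ^ k - 1).choose ν : ℚ_[p]) * ((ν : ℚ_[p]) + 1)⁻¹) -
          ((p ^ k - 1).choose ν : ℚ_[p]) := fun k => by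
      have h0 : (p : ℚ_[p]) ^ k ≠ 0 := pow_ne_zero _ (by exact_mod_cast hp.out.ne_zero)
      rw [← choose_div_eq, cast_prime_pow_sub_one, mul_inv_cancel_left₀ h0, Nat.choose_succ_succ]
      push_cast
      ring
    simp_rw [h1]
    have := (tendsto_prime_pow (p := p)).mul (ih.mul_const ((ν : ℚ_[p]) + 1)⁻¹)
    simpa [pow_succ] using this.sub ih

/-- The divided powers `((1 + p a) ^ (p ^ k) - 1) / p ^ k` converge to `log (1 + p a)`, in terms
of the images `t ν` of the powers `a ^ (ν + 1)` under a functional. -/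
theorem tendsto_divided_pow (t : ℕ → ℚ_[p]) (ht : ∀ ν, ‖t ν‖ ≤ 1) :
    Tendsto (fun k : ℕ => ((p : ℚ_[p]) ^ k)⁻¹ * ∑ ν ∈ Finset.range (p ^ k),
      ((p ^ k).choose (ν + 1) : ℚ_[p]) * ((p : ℚ_[p]) ^ (ν + 1) * t ν))
      atTop (𝓝 (∑' ν, logCoeff p ν * t ν)) := by
  have h1 : ∀ k : ℕ, ((p : ℚ_[p]) ^ k)⁻¹ * ∑ ν ∈ Finset.range (p ^ k),
      ((p ^ k).choose (ν + 1) : ℚ_[p]) * ((p : ℚ_[p]) ^ (ν + 1) * t ν) =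
      ∑' ν, ((p ^ k - 1).choose ν : ℚ_[p]) * ((ν : ℚ_[p]) + 1)⁻¹ *
        ((p : ℚ_[p]) ^ (ν + 1) * t ν) := fun k => by
    have hk : p ^ k - 1 + 1 = p ^ k := Nat.sub_add_cancel (Nat.one_le_pow _ _ hp.out.pos)
    rw [tsum_eq_sum (s := Finset.range (p ^ k)), Finset.mul_sum]
    · refine Finset.sum_congr rfl fun ν _ => ?_
      rw [← choose_div_eq, cast_prime_pow_sub_one, hk, mul_assoc]
    · intro ν hν
      rw [Finset.mem_range, not_lt] at hν
      rw [Nat.choose_eq_zero_of_lt (by omega)]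
      simp
  simp_rw [h1]
  -- Termwise limits come from the binomial coefficients; the bound `(ν + 1) p ^ (-(ν + 1))` is
  -- uniform in `k` because binomial coefficients are integers.
  refine tendsto_tsum_of_dominated_convergence (Padic.summable_succ_mul_pow (p := p))
    (fun ν => ?_) (Eventually.of_forall fun k ν => ?_)
  · rw [logCoeff, mul_assoc]
    simpa only [mul_assoc] using (tendsto_choose_prime_pow_sub_one (p := p) ν).mul_const
      (((ν : ℚ_[p]) + 1)⁻¹ * ((p : ℚ_[p]) ^ (ν + 1) * t ν))
  · rw [norm_mul, norm_mul, norm_mul, Padic.norm_p_pow_eq]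
    have h2 := Padic.norm_natCast_le (p := p) ((p ^ k - 1).choose ν)
    have h3 := Padic.norm_natCast_succ_inv_le (p := p) ν
    calc _ ≤ 1 * ((ν : ℝ) + 1) * (((p : ℝ)⁻¹) ^ (ν + 1) * 1) := by
          gcongr
          exact ht ν
      _ = _ := by ring

theorem logSeries_term {B : Type*} [Ring B] [Algebra ℚ_[p] B] (a : B) (ν : ℕ) :
    ((ν : ℚ_[p]) + 1)⁻¹ • (1 - (1 + (p : ℚ_[p]) • a)) ^ (ν + 1) =
      -(logCoeff p ν • a ^ (ν + 1)) := by
  rw [sub_add_cancel_left, ← neg_smul, smul_pow, smul_smul, ← neg_smul, logCoeff]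
  congr 1
  rw [neg_pow, pow_succ (-1 : ℚ_[p])]
  ring

theorem logSeries_eq_tsum (x : ℚ_[p]) :
    logSeries p (1 + (p : ℚ_[p]) * x) = ∑' ν, logCoeff p ν * x ^ (ν + 1) := by
  have h := fun ν => logSeries_term (p := p) x ν
  simp only [smul_eq_mul] at h
  simp only [logSeries, smul_eq_mul, h, tsum_neg, neg_neg]

theorem one_add_pow_sub_one {B : Type*} [Ring B] [Algebra ℚ_[p] B] (a : B) (q : ℕ) :
    (1 + (p : ℚ_[p]) • a) ^ q - 1 = ∑ ν ∈ Finset.range q,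
      ((q.choose (ν + 1) : ℚ_[p]) * (p : ℚ_[p]) ^ (ν + 1)) • a ^ (ν + 1) := by
  rw [add_comm, (Commute.one_right _).add_pow, Finset.sum_range_succ']
  simp only [one_pow, mul_one, pow_zero, Nat.choose_zero_right, Nat.cast_one, add_sub_cancel_right]
  refine Finset.sum_congr rfl fun ν _ => ?_
  rw [smul_pow, mul_smul, Algebra.smul_def (((q.choose (ν + 1) : ℕ) : ℚ_[p])), map_natCast,
    Nat.cast_comm]

/-- The `1`-units `1 + p ℤ_p`. -/
def IsPadicOneUnit (x : ℚ_[p]) : Prop := ∃ t : ℤ_[p], x = 1 + (p : ℚ_[p]) * t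

/-- Describing the logarithm as a limit of divided powers makes its functional equation, and later
its relation to determinants, elementary. -/
theorem IsPadicOneUnit.tendsto_logSeries {x : ℚ_[p]} (hx : IsPadicOneUnit x) :
    Tendsto (fun k : ℕ => ((p : ℚ_[p]) ^ k)⁻¹ * (x ^ p ^ k - 1)) atTop (𝓝 (logSeries p x)) := by
  obtain ⟨t, rfl⟩ := hx
  rw [logSeries_eq_tsum]
  refine (tendsto_divided_pow (fun ν => (t : ℚ_[p]) ^ (ν + 1)) fun ν => ?_).congr fun k => ?_
  · rw [norm_pow]
    exact pow_le_one₀ (norm_nonneg _) t.norm_le_one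
  · have := one_add_pow_sub_one (p := p) (t : ℚ_[p]) (p ^ k)
    simp only [smul_eq_mul, mul_assoc] at this
    rw [this]

theorem IsPadicOneUnit.mul {x y : ℚ_[p]} (hx : IsPadicOneUnit x) (hy : IsPadicOneUnit y) :
    IsPadicOneUnit (x * y) := by
  obtain ⟨s, rfl⟩ := hx
  obtain ⟨t, rfl⟩ := hy
  exact ⟨s + t + p * s * t, by push_cast; ring⟩

theorem IsPadicOneUnit.one : IsPadicOneUnit (1 : ℚ_[p]) := ⟨0, by simp⟩

theorem IsPadicOneUnit.pow {x : ℚ_[p]} (hx : IsPadicOneUnit x) (n : ℕ) :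
    IsPadicOneUnit (x ^ n) := by
  induction n with
  | zero => simpa using IsPadicOneUnit.one
  | succ n ih => simpa [pow_succ] using ih.mul hx

/-- With `q = p ^ k`, `a = (x ^ q - 1) / q` and `b = (y ^ q - 1) / q`, one has `((x y) ^ q - 1) / q
= q a b + a + b`, and `q → 0`. -/
theorem IsPadicOneUnit.logSeries_mul {x y : ℚ_[p]} (hx : IsPadicOneUnit x)
    (hy : IsPadicOneUnit y) : logSeries p (x * y) = logSeries p x + logSeries p y := by
  have h1 := hx.tendsto_logSeries
  have h2 := hy.tendsto_logSeries
  have h3 := (((tendsto_prime_pow (p := p)).mul (h1.mul h2)).add h1).add h2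
  rw [zero_mul, zero_add] at h3
  refine tendsto_nhds_unique (hx.mul hy).tendsto_logSeries (h3.congr fun k => ?_)
  have h0 : (p : ℚ_[p]) ^ k ≠ 0 := pow_ne_zero _ (by exact_mod_cast hp.out.ne_zero)
  field_simp
  ring

theorem logSeries_one : logSeries p (1 : ℚ_[p]) = 0 := by
  have := IsPadicOneUnit.one.logSeries_mul (IsPadicOneUnit.one (p := p))
  simpa using this

theorem IsPadicOneUnit.logSeries_pow {x : ℚ_[p]} (hx : IsPadicOneUnit x) (n : ℕ) :
    logSeries p (x ^ n) = n * logSeries p x := by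
  induction n with
  | zero => simp [logSeries_one]
  | succ n ih =>
    rw [pow_succ, (hx.pow n).logSeries_mul hx, ih]
    push_cast
    ring

theorem IsPadicOneUnit.ne_zero {x : ℚ_[p]} (hx : IsPadicOneUnit x) : x ≠ 0 := by
  obtain ⟨t, rfl⟩ := hx
  intro h
  have h1 : ‖(p : ℚ_[p]) * t‖ = 1 := by
    rw [eq_neg_of_add_eq_zero_right h, norm_neg, norm_one]
  rw [norm_mul] at h1
  have h2 : ‖(p : ℚ_[p])‖ * ‖(t : ℚ_[p])‖ ≤ ‖(p : ℚ_[p])‖ * 1 := by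
    gcongr
    exact t.norm_le_one
  have := Padic.norm_p_lt_one (p := p)
  linarith

theorem IsPadicOneUnit.valuation_eq_zero {x : ℚ_[p]} (hx : IsPadicOneUnit x) :
    x.valuation = 0 := by
  have h0 := hx.ne_zero
  obtain ⟨t, rfl⟩ := hx
  have h1 : ‖(p : ℚ_[p]) * t‖ < 1 := by
    rw [norm_mul]
    exact mul_lt_one_of_nonneg_of_lt_one_left (norm_nonneg _) Padic.norm_p_lt_one t.norm_le_one
  have h2 : ‖1 + (p : ℚ_[p]) * t‖ = 1 := by
    have := IsUltrametricDist.norm_add_eq_max_of_norm_ne_norm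
      (x := (1 : ℚ_[p])) (y := (p : ℚ_[p]) * t) (by rw [norm_one]; exact h1.ne')
    rw [this, norm_one, max_eq_left h1.le]
  rw [Padic.norm_eq_zpow_neg_valuation h0,
    zpow_eq_one_iff_right₀ (by positivity) (by exact_mod_cast hp.out.one_lt.ne')] at h2
  exact neg_eq_zero.mp h2

/-- The unit part of `x ≠ 0`, raised to the power `p - 1`, is a `1`-unit. -/
theorem isPadicOneUnit_unitPart {x : ℚ_[p]} (hx : x ≠ 0) :
    IsPadicOneUnit ((x * (p : ℚ_[p]) ^ (-x.valuation)) ^ (p - 1)) := by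
  have h1 : ‖x * (p : ℚ_[p]) ^ (-x.valuation)‖ = 1 := by
    have hp0 : (p : ℝ) ≠ 0 := by exact_mod_cast hp.out.ne_zero
    rw [norm_mul, norm_zpow, Padic.norm_p, Padic.norm_eq_zpow_neg_valuation hx, inv_zpow',
      ← zpow_add₀ hp0]
    simp
  obtain ⟨u, hu⟩ : ∃ u : ℤ_[p], (u : ℚ_[p]) = x * (p : ℚ_[p]) ^ (-x.valuation) := ⟨⟨_, h1.le⟩, rfl⟩
  -- A unit of `ℤ_p` is non-zero mod `p`, so Fermat's little theorem puts its power `p - 1` in `1 +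
  -- p ℤ_p`.
  have hu1 : PadicInt.toZMod u ≠ 0 := by
    intro h
    rw [← RingHom.mem_ker, PadicInt.ker_toZMod, IsLocalRing.mem_maximalIdeal,
      PadicInt.mem_nonunits, PadicInt.norm_def, hu, h1] at h
    exact lt_irrefl _ h
  have h2 : u ^ (p - 1) - 1 ∈ RingHom.ker (PadicInt.toZMod (p := p)) := by
    rw [RingHom.mem_ker, map_sub, map_pow, map_one, ZMod.pow_card_sub_one_eq_one hu1, sub_self]
  rw [PadicInt.ker_toZMod, PadicInt.maximalIdeal_eq_span_p, Ideal.mem_span_singleton] at h2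
  obtain ⟨t, ht⟩ := h2
  refine ⟨t, ?_⟩
  rw [← hu]
  have := congrArg (fun z : ℤ_[p] => (z : ℚ_[p])) ht
  push_cast at this
  linear_combination this

theorem cast_prime_sub_one_ne_zero : (p : ℚ_[p]) - 1 ≠ 0 := by
  rw [sub_ne_zero]
  exact_mod_cast hp.out.one_lt.ne'

theorem padicLog_mul {x y : ℚ_[p]} (hx : x ≠ 0) (hy : y ≠ 0) :
    padicLog (x * y) = padicLog x + padicLog y := by
  have hp0 : (p : ℚ_[p]) ≠ 0 := by exact_mod_cast hp.out.ne_zero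
  rw [padicLog, padicLog, padicLog, Padic.valuation_mul hx hy, neg_add, zpow_add₀ hp0,
    mul_mul_mul_comm, mul_pow,
    (isPadicOneUnit_unitPart hx).logSeries_mul (isPadicOneUnit_unitPart hy), mul_add]

theorem IsPadicOneUnit.padicLog_eq {x : ℚ_[p]} (hx : IsPadicOneUnit x) :
    padicLog x = logSeries p x := by
  rw [padicLog, hx.valuation_eq_zero, neg_zero, zpow_zero, mul_one, hx.logSeries_pow,
    Nat.cast_sub hp.out.one_lt.le, Nat.cast_one, inv_mul_cancel_left₀ cast_prime_sub_one_ne_zero]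

theorem padicLog_one : padicLog (1 : ℚ_[p]) = 0 := by
  rw [IsPadicOneUnit.one.padicLog_eq, logSeries_one]

theorem padicLog_prime : padicLog (p : ℚ_[p]) = 0 := by
  have hp0 : (p : ℚ_[p]) ≠ 0 := by exact_mod_cast hp.out.ne_zero
  rw [padicLog, Padic.valuation_p, zpow_neg, zpow_one, mul_inv_cancel₀ hp0, one_pow,
    logSeries_one, mul_zero]

theorem padicLog_pow {x : ℚ_[p]} (hx : x ≠ 0) (n : ℕ) : padicLog (x ^ n) = n * padicLog x := by
  induction n with
  | zero => simp [padicLog_one]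
  | succ n ih =>
    rw [pow_succ, padicLog_mul (pow_ne_zero n hx) hx, ih]
    push_cast
    ring

/-! ### The logarithm of a determinant -/

/-- The congruence is universal: in `ℤ_p[T]`, `p ^ (k + 1)` divides `(1 + p T) ^ (p ^ k) - 1`, and
one evaluates at the matrix. The spare factor `p` is absorbed into `Y`. -/
theorem PadicInt.exists_one_add_smul_pow {n : Type*} [Fintype n] [DecidableEq n]
    (X : Matrix n n ℤ_[p]) (k : ℕ) :
    ∃ Y : Matrix n n ℤ_[p], (1 + (p : ℤ_[p]) • X) ^ p ^ k = 1 + (p : ℤ_[p]) ^ k • Y := by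
  have h : ((p : ℕ) : Polynomial ℤ_[p]) ∣ (1 + (p : Polynomial ℤ_[p]) * Polynomial.X) - 1 :=
    ⟨Polynomial.X, by ring⟩
  obtain ⟨g, hg⟩ := dvd_sub_pow_of_dvd_sub h k
  refine ⟨Polynomial.aeval X ((p : Polynomial ℤ_[p]) * g), ?_⟩
  have := congrArg (Polynomial.aeval X) hg
  simp only [one_pow, map_sub, map_pow, map_add, map_one, map_mul, map_natCast,
    Polynomial.aeval_X] at this
  simp only [map_mul, map_natCast]
  rw [sub_eq_iff_eq_add'] at this
  rw [Algebra.smul_def, Algebra.smul_def, map_pow, map_natCast, this, pow_succ, mul_assoc]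

theorem Matrix.exists_det_one_add_smul {R n : Type*} [CommRing R] [Fintype n] [DecidableEq n]
    (r : R) (M : Matrix n n R) : ∃ c, (1 + r • M).det = 1 + M.trace * r + c * r ^ 2 :=
  ⟨_, Matrix.det_one_add_smul r M⟩

/-- `log det (1 + p X) = tr log (1 + p X)` for a matrix `X` over `ℤ_p`. -/
theorem padicLog_det_one_add_smul {n : Type*} [Fintype n] [DecidableEq n]
    (X : Matrix n n ℚ_[p]) (hX : ∀ i j, ‖X i j‖ ≤ 1) :
    (1 + (p : ℚ_[p]) • X).det ≠ 0 ∧ padicLog (1 + (p : ℚ_[p]) • X).det =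
      ∑' ν, logCoeff p ν * (X ^ (ν + 1)).trace := by
  obtain ⟨Z, rfl⟩ : ∃ Z : Matrix n n ℤ_[p], Z.map PadicInt.Coe.ringHom = X :=
    ⟨fun i j => ⟨X i j, hX i j⟩, rfl⟩
  have hcoe : ∀ z : ℤ_[p], PadicInt.Coe.ringHom z = (z : ℚ_[p]) := fun _ => rfl
  have hmap : 1 + (p : ℚ_[p]) • Z.map PadicInt.Coe.ringHom =
      (1 + (p : ℤ_[p]) • Z).map PadicInt.Coe.ringHom := by
    ext i j
    simp [Matrix.one_apply, apply_ite]
  have hdet : (1 + (p : ℚ_[p]) • Z.map PadicInt.Coe.ringHom).det =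
      ((1 + (p : ℤ_[p]) • Z).det : ℤ_[p]) := by
    rw [hmap, ← RingHom.mapMatrix_apply, ← RingHom.map_det, hcoe]
  have hunit : IsPadicOneUnit (1 + (p : ℚ_[p]) • Z.map PadicInt.Coe.ringHom).det := by
    obtain ⟨c, hc⟩ := Matrix.exists_det_one_add_smul (p : ℤ_[p]) Z
    refine ⟨Z.trace + c * p, ?_⟩
    rw [hdet, hc]
    push_cast
    ring
  refine ⟨hunit.ne_zero, ?_⟩
  rw [hunit.padicLog_eq]
  -- Taking determinants of `(1 + p Z) ^ (p ^ k) = 1 + p ^ k Y_k` gives `det (1 + p Z) ^ (p ^ k) = 1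
  -- + p ^ k tr Y_k + p ^ (2 k) c_k`. Dividing by `p ^ k` yields the logarithm of the determinant on
  -- the left in the limit, and `lim tr Y_k` on the right.
  choose Y hY using PadicInt.exists_one_add_smul_pow (p := p) Z
  choose c hc using fun k => Matrix.exists_det_one_add_smul ((p : ℤ_[p]) ^ k) (Y k)
  have htr : ∀ M : Matrix n n ℤ_[p], (M.map PadicInt.Coe.ringHom).trace = (M.trace : ℚ_[p]) :=
    fun M => by
      rw [← hcoe, Matrix.trace, Matrix.trace, map_sum]
      rfl
  have h1 := tendsto_divided_pow (p := p)
    (fun ν => ((Z.map PadicInt.Coe.ringHom) ^ (ν + 1)).trace) fun ν => by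
      rw [← RingHom.mapMatrix_apply, ← map_pow, RingHom.mapMatrix_apply, htr]
      exact PadicInt.norm_le_one _
  have h2 : Tendsto (fun k => (p : ℚ_[p]) ^ k * (c k : ℚ_[p])) atTop (𝓝 0) := by
    refine squeeze_zero_norm (a := fun k => ‖(p : ℚ_[p]) ^ k‖) (fun k => ?_) ?_
    · rw [norm_mul]
      exact mul_le_of_le_one_right (norm_nonneg _) (c k).norm_le_one
    · simpa using (tendsto_prime_pow (p := p)).norm
  have h3 := h1.add h2
  rw [add_zero] at h3
  refine tendsto_nhds_unique hunit.tendsto_logSeries (h3.congr fun k => ?_)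
  have h0 : (p : ℚ_[p]) ^ k ≠ 0 := pow_ne_zero _ (by exact_mod_cast hp.out.ne_zero)
  -- `Y_k` is the divided power of the matrix, so its trace is the expression whose limit is the
  -- trace of the logarithmic series.
  have h4 : (Y k).map PadicInt.Coe.ringHom = ((p : ℚ_[p]) ^ k)⁻¹ •
      ((1 + (p : ℚ_[p]) • Z.map PadicInt.Coe.ringHom) ^ p ^ k - 1) := by
    rw [hmap, ← RingHom.mapMatrix_apply, ← RingHom.mapMatrix_apply, ← map_pow, hY, map_add,
      map_one, add_sub_cancel_left, eq_inv_smul_iff₀ h0]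
    ext i j
    simp
  have h5 : ((Y k).trace : ℚ_[p]) = ((p : ℚ_[p]) ^ k)⁻¹ * ∑ ν ∈ Finset.range (p ^ k),
      ((p ^ k).choose (ν + 1) : ℚ_[p]) *
        ((p : ℚ_[p]) ^ (ν + 1) * ((Z.map PadicInt.Coe.ringHom) ^ (ν + 1)).trace) := by
    rw [← htr, h4, one_add_pow_sub_one, Matrix.trace_smul, Matrix.trace_sum, smul_eq_mul]
    simp only [Matrix.trace_smul, smul_eq_mul, mul_assoc]
  rw [← h5, hdet]
  have h6 := congrArg (fun z : ℤ_[p] => (z : ℚ_[p])) ((congrArg Matrix.det (hY k)).trans (hc k))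
  rw [Matrix.det_pow] at h6
  push_cast at h6
  rw [h6]
  field_simp
  ring

end PadicLogarithm

/-! ### `c₀(Γ)` as a complete ultrametric normed algebra -/

namespace C0

section Norm

variable {p : ℕ} [hp : Fact p.Prime] {Γ : Type*}

theorem norm_le_iff {x : C0 p Γ} {C : ℝ} (hC : 0 ≤ C) : ‖x‖ ≤ C ↔ ∀ γ, ‖x.coeff γ‖ ≤ C :=
  ⟨fun h γ => (norm_coeff_le x γ).trans h, fun h => Real.iSup_le h hC⟩

instance : IsUltrametricDist (C0 p Γ) :=
  IsUltrametricDist.isUltrametricDist_of_forall_norm_add_le_max_norm fun x y =>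
    (norm_le_iff (le_max_of_le_left (norm_nonneg x))).mpr fun γ =>
      (IsUltrametricDist.norm_add_le_max _ _).trans
        (max_le_max (norm_coeff_le x γ) (norm_coeff_le y γ))

noncomputable instance : NormedSpace ℚ_[p] (C0 p Γ) where
  norm_smul_le c x := (norm_le_iff (by positivity)).mpr fun γ => by
    rw [coeff_smul, norm_mul]
    exact mul_le_mul_of_nonneg_left (norm_coeff_le x γ) (norm_nonneg c)

/-- A Cauchy sequence converges uniformly in the coefficients, and a uniform limit of null families
is null. Completeness and the ultrametric inequality make every series with null terms summable. -/
instance : CompleteSpace (C0 p Γ) := by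
  refine Metric.complete_of_cauchySeq_tendsto fun u hu => ?_
  have hsub : ∀ γ m n, ‖(u m).coeff γ - (u n).coeff γ‖ ≤ ‖u m - u n‖ := fun γ m n =>
    norm_coeff_le (u m - u n) γ
  have hγ : ∀ γ, ∃ y, Tendsto (fun n => (u n).coeff γ) atTop (𝓝 y) := fun γ => by
    refine cauchySeq_tendsto_of_complete (Metric.cauchySeq_iff'.mpr fun ε hε => ?_)
    obtain ⟨N, hN⟩ := Metric.cauchySeq_iff'.mp hu ε hε
    refine ⟨N, fun n hn => ?_⟩
    rw [dist_eq_norm]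
    refine (hsub γ n N).trans_lt ?_
    rw [← dist_eq_norm]
    exact hN n hn
  choose y hy using hγ
  have hunif : ∀ ε > 0, ∃ N, ∀ n ≥ N, ∀ γ, ‖(u n).coeff γ - y γ‖ ≤ ε := fun ε hε => by
    obtain ⟨N, hN⟩ := Metric.cauchySeq_iff.mp hu ε hε
    refine ⟨N, fun n hn γ => ?_⟩
    refine le_of_tendsto ((tendsto_const_nhds.sub (hy γ)).norm)
      (eventually_atTop.mpr ⟨N, fun m hm => (hsub γ n m).trans ?_⟩)
    rw [← dist_eq_norm]
    exact (hN n hn m hm).le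
  have hzero : Tendsto y cofinite (𝓝 0) := by
    rw [Metric.tendsto_nhds]
    intro ε hε
    obtain ⟨N, hN⟩ := hunif (ε / 2) (half_pos hε)
    filter_upwards [Metric.tendsto_nhds.mp (u N).tendsto_zero (ε / 2) (half_pos hε)] with γ h
    rw [dist_zero_right] at h ⊢
    calc ‖y γ‖ = ‖(u N).coeff γ - ((u N).coeff γ - y γ)‖ := by rw [sub_sub_cancel]
      _ ≤ ‖(u N).coeff γ‖ + ‖(u N).coeff γ - y γ‖ := norm_sub_le _ _
      _ < ε / 2 + ε / 2 := add_lt_add_of_lt_of_le h (hN N le_rfl γ)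
      _ = ε := add_halves ε
  refine ⟨⟨y, hzero⟩, Metric.tendsto_atTop.mpr fun ε hε => ?_⟩
  obtain ⟨N, hN⟩ := hunif (ε / 2) (half_pos hε)
  refine ⟨N, fun n hn => ?_⟩
  rw [dist_eq_norm]
  exact ((norm_le_iff (half_pos hε).le).mpr fun γ => hN n hn γ).trans_lt (half_lt_self hε)

end Norm

section NormedRing

variable {p : ℕ} [hp : Fact p.Prime] {Γ : Type*} [Group Γ]

noncomputable instance : NormedRing (C0 p Γ) where
  __ := (inferInstance : NormedAddCommGroup (C0 p Γ))
  __ := (inferInstance : Ring (C0 p Γ))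
  norm_mul_le x y := (norm_le_iff (by positivity)).mpr fun γ => by
    rw [coeff_mul]
    refine IsUltrametricDist.norm_tsum_le_of_forall_le_of_nonneg (by positivity) fun a => ?_
    rw [norm_mul]
    exact mul_le_mul (norm_coeff_le _ _) (norm_coeff_le _ _) (norm_nonneg _) (norm_nonneg _)

theorem mem_integral_iff {x : C0 p Γ} : x ∈ integral p Γ ↔ ‖x‖ ≤ 1 :=
  (norm_le_iff zero_le_one).symm

theorem norm_integral_le (x : integral p Γ) : ‖(x : C0 p Γ)‖ ≤ 1 := mem_integral_iff.mp x.2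

/-- Extension of scalars from `c₀(Γ, ℤ_p)` to `c₀(Γ)` for matrices. -/
noncomputable abbrev matVal (p : ℕ) [Fact p.Prime] (Γ : Type*) [Group Γ] (r : ℕ) :
    Matrix (Fin r) (Fin r) (integral p Γ) →+* Matrix (Fin r) (Fin r) (C0 p Γ) :=
  (integral p Γ).subtype.mapMatrix

theorem matVal_injective (r : ℕ) : Function.Injective (matVal p Γ r) := fun a b h => by
  ext i j : 2
  exact congrFun (congrFun h i) j

theorem norm_matVal_le {r : ℕ} (a : Matrix (Fin r) (Fin r) (integral p Γ)) (i j : Fin r) :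
    ‖matVal p Γ r a i j‖ ≤ 1 := norm_integral_le (a i j)

theorem summable_smul_matrix {r : ℕ} {c : ℕ → ℚ_[p]} (hc : Tendsto c atTop (𝓝 0))
    {M : ℕ → Matrix (Fin r) (Fin r) (C0 p Γ)} (hM : ∀ ν i j, ‖M ν i j‖ ≤ 1) :
    Summable fun ν => c ν • M ν := by
  refine Pi.summable.mpr fun i => Pi.summable.mpr fun j => ?_
  apply NonarchimedeanAddGroup.summable_of_tendsto_cofinite_zero
  rw [Nat.cofinite_eq_atTop]
  refine squeeze_zero_norm (a := fun ν => ‖c ν‖) (fun ν => ?_) (by simpa using hc.norm)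
  change ‖c ν • M ν i j‖ ≤ ‖c ν‖
  rw [norm_smul]
  exact mul_le_of_le_one_right (norm_nonneg _) (hM ν i j)

theorem prime_smul_matVal {r : ℕ} (a : Matrix (Fin r) (Fin r) (integral p Γ)) :
    (p : ℚ_[p]) • matVal p Γ r a = matVal p Γ r ((p : ℕ) • a) := by
  rw [map_nsmul, Nat.cast_smul_eq_nsmul]

/-- The inverse is the geometric series in `-p a`. It is summed over `c₀(Γ)`, and the ultrametric
inequality shows that its entries are again integral. -/
theorem isUnit_one_add_prime_nsmul {r : ℕ} (a : Matrix (Fin r) (Fin r) (integral p Γ)) :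
    IsUnit (1 + p • a) := by
  set N : Matrix (Fin r) (Fin r) (C0 p Γ) := matVal p Γ r (-(p • a)) with hN
  have hpow : ∀ ν : ℕ, N ^ ν = ((p : ℚ_[p]) ^ ν) • matVal p Γ r ((-a) ^ ν) := fun ν => by
    rw [hN, ← smul_neg, ← prime_smul_matVal, smul_pow, map_pow]
  have hs : Summable fun ν => N ^ ν := by
    simp_rw [hpow]
    exact summable_smul_matrix tendsto_prime_pow fun ν i j => norm_matVal_le _ i j
  have hG : ∀ i j, ‖(∑' ν, N ^ ν) i j‖ ≤ 1 := fun i j => by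
    have h1 : (∑' ν, N ^ ν) i j = ∑' ν, (N ^ ν) i j := by
      have h := (Pi.hasSum.mp (Pi.hasSum.mp hs.hasSum i) j)
      exact h.tsum_eq.symm
    rw [h1]
    refine IsUltrametricDist.norm_tsum_le_of_forall_le_of_nonneg zero_le_one fun ν => ?_
    have : N ^ ν = matVal p Γ r ((-(p • a)) ^ ν) := by rw [map_pow]
    rw [this]
    exact norm_matVal_le _ i j
  obtain ⟨g, hg⟩ : ∃ g, matVal p Γ r g = ∑' ν, N ^ ν :=
    ⟨Matrix.of fun i j => ⟨_, mem_integral_iff.mpr (hG i j)⟩, rfl⟩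
  have h1 : 1 - N = matVal p Γ r (1 + p • a) := by
    rw [hN, map_neg, sub_neg_eq_add, map_add, map_one]
  refine ⟨⟨1 + p • a, g, matVal_injective r ?_, matVal_injective r ?_⟩, rfl⟩
  · rw [map_mul, hg, ← h1, hs.one_sub_mul_tsum_pow, map_one]
  · rw [map_mul, hg, ← h1, hs.tsum_pow_mul_one_sub, map_one]

/-- The trace of the logarithm of `1 + p a` as a convergent series in `c₀(Γ)`. -/
theorem hasSum_trace_logSeries {r : ℕ} (a : Matrix (Fin r) (Fin r) (integral p Γ)) :
    HasSum (fun ν => logCoeff p ν • (matVal p Γ r a ^ (ν + 1)).trace)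
      (logSeries p (1 + (p : ℚ_[p]) • matVal p Γ r a)).trace := by
  have hs : Summable fun ν => logCoeff p ν • matVal p Γ r a ^ (ν + 1) := by
    refine summable_smul_matrix tendsto_logCoeff fun ν i j => ?_
    rw [← map_pow]
    exact norm_matVal_le _ i j
  have h1 : logSeries p (1 + (p : ℚ_[p]) • matVal p Γ r a) =
      ∑' ν, logCoeff p ν • matVal p Γ r a ^ (ν + 1) := by
    rw [logSeries]
    simp only [logSeries_term, tsum_neg, neg_neg]
  rw [h1]
  have h2 := hs.hasSum.map (Matrix.traceAddMonoidHom (Fin r) (C0 p Γ))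
    (Continuous.matrix_trace continuous_id)
  simpa only [Function.comp_def, Matrix.traceAddMonoidHom_apply, Matrix.trace_smul] using h2

end NormedRing

end C0

/-! ### The regular representations of the finite quotients -/

attribute [instance] Subgroup.fintypeQuotientOfFiniteIndex

noncomputable instance quotientDecidableEq {Γ : Type*} [Group Γ] (N : Subgroup Γ) :
    DecidableEq (Γ ⧸ N) := Classical.decEq _

namespace C0

section Quotient

variable {p : ℕ} [hp : Fact p.Prime] {Γ : Type*} [Group Γ] (N : Subgroup Γ)

/-- The sum of the coefficients of `x` over the coset `δ`. -/
noncomputable def cosetSum (x : C0 p Γ) (δ : Γ ⧸ N) : ℚ_[p] :=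
  ∑' γ : {γ : Γ // (γ : Γ ⧸ N) = δ}, x.coeff γ

/-- The characteristic function of the coset `δ`. -/
noncomputable def cosetInd (p : ℕ) [Fact p.Prime] (δ : Γ ⧸ N) (γ : Γ) : ℚ_[p] :=
  if (γ : Γ ⧸ N) = δ then 1 else 0

theorem norm_cosetInd_le (δ : Γ ⧸ N) (γ : Γ) : ‖cosetInd N p δ γ‖ ≤ 1 := by
  unfold cosetInd
  split_ifs <;> simp

theorem cosetSum_eq (x : C0 p Γ) (δ : Γ ⧸ N) :
    cosetSum N x δ = ∑' γ, cosetInd N p δ γ * x.coeff γ := by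
  have := tsum_subtype {γ : Γ | (γ : Γ ⧸ N) = δ} x.coeff
  refine Eq.trans this (tsum_congr fun γ => ?_)
  simp [Set.indicator_apply, cosetInd]

theorem summable_cosetInd_mul (x : C0 p Γ) (δ : Γ ⧸ N) :
    Summable fun γ => cosetInd N p δ γ * x.coeff γ := by
  apply NonarchimedeanAddGroup.summable_of_tendsto_cofinite_zero
  refine squeeze_zero_norm (a := fun γ => ‖x.coeff γ‖) (fun γ => ?_)
    (by simpa using x.tendsto_zero.norm)
  rw [norm_mul]
  exact mul_le_of_le_one_left (norm_nonneg _) (norm_cosetInd_le N δ γ)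

theorem norm_cosetSum_le (x : C0 p Γ) (δ : Γ ⧸ N) : ‖cosetSum N x δ‖ ≤ ‖x‖ :=
  IsUltrametricDist.norm_tsum_le_of_forall_le_of_nonneg (norm_nonneg x) fun _ => norm_coeff_le x _

theorem cosetSum_add (x y : C0 p Γ) (δ : Γ ⧸ N) :
    cosetSum N (x + y) δ = cosetSum N x δ + cosetSum N y δ := by
  simp only [cosetSum_eq, coeff_add, mul_add]
  exact (summable_cosetInd_mul N x δ).tsum_add (summable_cosetInd_mul N y δ)

theorem cosetSum_smul (c : ℚ_[p]) (x : C0 p Γ) (δ : Γ ⧸ N) :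
    cosetSum N (c • x) δ = c * cosetSum N x δ := by
  simp only [cosetSum_eq, coeff_smul, mul_left_comm _ c, tsum_mul_left]

theorem cosetSum_delta (g : Γ) (δ : Γ ⧸ N) :
    cosetSum N (delta p g) δ = if (g : Γ ⧸ N) = δ then 1 else 0 := by
  rw [cosetSum_eq, tsum_eq_single g]
  · rw [delta_self, mul_one, cosetInd]
  · intro b hb
    rw [delta_ne hb, mul_zero]

/-- The sum over a coset as an additive functional. -/
noncomputable def cosetSumHom (p : ℕ) [Fact p.Prime] (δ : Γ ⧸ N) : C0 p Γ →+ ℚ_[p] where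
  toFun x := cosetSum N x δ
  map_zero' := by simp [cosetSum]
  map_add' x y := cosetSum_add N x y δ

/-- Continuity allows coset sums to be taken term by term in the logarithmic series. -/
theorem continuous_cosetSumHom (δ : Γ ⧸ N) : Continuous (cosetSumHom N p δ) :=
  AddMonoidHomClass.continuous_of_bound (cosetSumHom N p δ) 1 fun x => by
    rw [one_mul]
    exact norm_cosetSum_le N x δ

variable [N.Normal]

theorem cosetInd_mul (δ : Γ ⧸ N) (a b : Γ) :
    cosetInd N p δ (a * b) = cosetInd N p ((a : Γ ⧸ N)⁻¹ * δ) b := by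
  unfold cosetInd
  exact if_congr (by rw [QuotientGroup.mk_mul, eq_inv_mul_iff_mul_eq]) rfl rfl

variable [N.FiniteIndex]

/-- Reduction to the finite quotient is multiplicative: interchange the sums, substitute `γ = a b`,
and group the `a` by cosets. Null families make every rearrangement legitimate. -/
theorem cosetSum_mul (x y : C0 p Γ) (δ : Γ ⧸ N) :
    cosetSum N (x * y) δ = ∑ ε : Γ ⧸ N, cosetSum N x ε * cosetSum N y (ε⁻¹ * δ) := by
  have hs : Summable fun q : Γ × Γ =>
      cosetInd N p δ q.2 * (x.coeff q.1 * y.coeff (q.1⁻¹ * q.2)) := by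
    apply NonarchimedeanAddGroup.summable_of_tendsto_cofinite_zero
    refine squeeze_zero_norm (a := fun q : Γ × Γ =>
      ‖x.coeff q.1 * y.coeff (q.1⁻¹ * q.2)‖) (fun q => ?_)
      (by simpa using (summable_pair x y).tendsto_cofinite_zero.norm)
    rw [norm_mul]
    exact mul_le_of_le_one_left (norm_nonneg _) (norm_cosetInd_le N δ _)
  have hx : Summable fun a : Γ => x.coeff a * cosetSum N y ((a : Γ ⧸ N)⁻¹ * δ) := by
    apply NonarchimedeanAddGroup.summable_of_tendsto_cofinite_zero
    refine squeeze_zero_norm (a := fun a => ‖x.coeff a‖ * ‖y‖) (fun a => ?_)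
      (by simpa using x.tendsto_zero.norm.mul_const ‖y‖)
    rw [norm_mul]
    exact mul_le_mul_of_nonneg_left (norm_cosetSum_le N y _) (norm_nonneg _)
  calc cosetSum N (x * y) δ
      = ∑' γ, ∑' a, cosetInd N p δ γ * (x.coeff a * y.coeff (a⁻¹ * γ)) := by
        rw [cosetSum_eq]
        exact tsum_congr fun γ => by rw [coeff_mul, tsum_mul_left]
    _ = ∑' a, ∑' γ, cosetInd N p δ γ * (x.coeff a * y.coeff (a⁻¹ * γ)) :=
        Summable.tsum_comm (f := fun a γ =>
          cosetInd N p δ γ * (x.coeff a * y.coeff (a⁻¹ * γ))) hs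
    _ = ∑' a : Γ, x.coeff a * cosetSum N y ((a : Γ ⧸ N)⁻¹ * δ) := by
        refine tsum_congr fun a => ?_
        rw [cosetSum_eq, ← tsum_mul_left, ← (Equiv.mulLeft a).tsum_eq]
        refine tsum_congr fun b => ?_
        rw [Equiv.coe_mulLeft, inv_mul_cancel_left, cosetInd_mul]
        ring
    _ = ∑ ε : Γ ⧸ N, cosetSum N x ε * cosetSum N y (ε⁻¹ * δ) := by
        have h := hx.hasSum.tsum_fiberwise (fun a : Γ => (a : Γ ⧸ N))
        rw [← h.tsum_eq, tsum_fintype]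
        refine Finset.sum_congr rfl fun ε _ => ?_
        rw [cosetSum, ← tsum_mul_right]
        refine tsum_congr fun a => ?_
        rw [show ((a : Γ) : Γ ⧸ N) = ε from a.2]

/-- The left regular representation of the image of `c₀(Γ)` in `ℚ_p[Γ/N]`. -/
noncomputable def regRep (p : ℕ) [Fact p.Prime] :
    C0 p Γ →+* Matrix (Γ ⧸ N) (Γ ⧸ N) ℚ_[p] where
  toFun x := Matrix.of fun h g => cosetSum N x (h⁻¹ * g)
  map_zero' := by
    ext h g
    exact map_zero (cosetSumHom N p _)
  map_add' x y := by
    ext h g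
    exact cosetSum_add N x y _
  map_one' := by
    ext h g
    refine (cosetSum_delta N 1 _).trans ?_
    rw [Matrix.one_apply, QuotientGroup.mk_one]
    exact if_congr (by rw [eq_comm, inv_mul_eq_one]) rfl rfl
  map_mul' x y := by
    ext h g
    rw [Matrix.mul_apply, Matrix.of_apply, cosetSum_mul]
    refine Fintype.sum_equiv (Equiv.mulLeft h) _ _ fun ε => ?_
    simp [mul_assoc]

/-- The representation of `M_r(c₀(Γ))` on `(ℚ_p[Γ/N])^r`, in coordinates. -/
noncomputable def matRep (p : ℕ) [Fact p.Prime] (r : ℕ) :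
    Matrix (Fin r) (Fin r) (C0 p Γ) →+*
      Matrix (Fin r × (Γ ⧸ N)) (Fin r × (Γ ⧸ N)) ℚ_[p] :=
  (Matrix.compRingEquiv (Fin r) (Γ ⧸ N) ℚ_[p]).toRingHom.comp (regRep N p).mapMatrix

theorem matRep_apply {r : ℕ} (f : Matrix (Fin r) (Fin r) (C0 p Γ)) (i j : Fin r × (Γ ⧸ N)) :
    matRep N p r f i j = cosetSum N (f i.1 j.1) (i.2⁻¹ * j.2) := rfl

theorem matRep_smul {r : ℕ} (c : ℚ_[p]) (f : Matrix (Fin r) (Fin r) (C0 p Γ)) :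
    matRep N p r (c • f) = c • matRep N p r f := by
  ext i j
  exact cosetSum_smul N c _ _

/-- Every diagonal entry of a regular representation is the coefficient at the neutral coset. The
resulting index is what the normalization in the limit cancels. -/
theorem trace_matRep {r : ℕ} (f : Matrix (Fin r) (Fin r) (C0 p Γ)) :
    (matRep N p r f).trace = (N.index : ℚ_[p]) * cosetSum N f.trace 1 := by
  have h1 : cosetSum N f.trace 1 = ∑ i, cosetSum N (f i i) 1 :=
    map_sum (cosetSumHom N p 1) _ _
  rw [h1, Matrix.trace, Fintype.sum_prod_type, Finset.mul_sum]
  refine Finset.sum_congr rfl fun i _ => ?_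
  simp [matRep_apply, Subgroup.index, Nat.card_eq_fintype_card]

theorem reduce_coeff (x : C0 p Γ) (δ : Γ ⧸ N) : (reduce N x).coeff δ = cosetSum N x δ := rfl

/-- In the standard basis the coefficient at `h` in component `j` of `(g e_i) f^*` is that of
`f_{ji}` at `h⁻¹ g`: the transpose and the inversion in `f^*` undo those of a right action on rows,
leaving `matRep` itself. -/
theorem detRho_eq {r : ℕ} (f : Matrix (Fin r) (Fin r) (C0 p Γ)) :
    detRho N f = (matRep N p r f).det := by
  rw [detRho, ← LinearMap.det_toMatrix ((Pi.basis fun _ : Fin r =>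
    MonoidAlgebra.basis (Γ ⧸ N) ℚ_[p]).reindex (Equiv.sigmaEquivProd (Fin r) (Γ ⧸ N)))]
  congr 1
  ext ⟨j, h⟩ ⟨i, g⟩
  have hinv : ∀ (z : MonoidAlgebra ℚ_[p] (Γ ⧸ N)) (δ : Γ ⧸ N),
      (MonoidAlgebra.mapDomain (fun g => g⁻¹) z).coeff δ = z.coeff δ⁻¹ := fun z δ => by
    rw [MonoidAlgebra.coeff_mapDomain]
    exact Finsupp.mapDomain_equiv_apply (f := Equiv.inv (Γ ⧸ N)) z.coeff δ
  rw [LinearMap.toMatrix_apply, Module.Basis.repr_reindex_apply, Module.Basis.reindex_apply,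
    matRep_apply]
  simp only [Equiv.sigmaEquivProd_symm_apply, Pi.basis_apply, MonoidAlgebra.basis_apply,
    Pi.basis_repr]
  change (Matrix.vecMul (Pi.single i (MonoidAlgebra.single g 1))
    ((f.map (reduce N)).transpose.map (MonoidAlgebra.mapDomain fun g => g⁻¹)) j).coeff h = _
  rw [Matrix.single_vecMul, Pi.smul_apply, smul_eq_mul, Matrix.row_apply,
    MonoidAlgebra.coeff_single_mul_apply, one_mul,
    Matrix.map_apply, hinv, Matrix.transpose_apply, Matrix.map_apply, reduce_coeff]
  simp

theorem detRho_mul {r : ℕ} (f g : Matrix (Fin r) (Fin r) (C0 p Γ)) :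
    detRho N (f * g) = detRho N f * detRho N g := by
  simp only [detRho_eq, map_mul, Matrix.det_mul]

theorem detRho_ne_zero_of_isUnit {r : ℕ} {f : Matrix (Fin r) (Fin r) (C0 p Γ)} (hf : IsUnit f) :
    detRho N f ≠ 0 := by
  rw [detRho_eq]
  exact ((Matrix.isUnit_iff_isUnit_det _).mp (hf.map (matRep N p r))).ne_zero

theorem detRho_stabMatrix {r s : ℕ} (hrs : r ≤ s) (f : Matrix (Fin r) (Fin r) (C0 p Γ)) :
    detRho N (stabMatrix r s f) = detRho N f := by
  obtain ⟨t, rfl⟩ := Nat.exists_eq_add_of_le hrs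
  rw [detRho_eq, detRho_eq]
  let e := (Equiv.sumProdDistrib (Fin r) (Fin t) (Γ ⧸ N)).symm.trans
    (finSumFinEquiv.prodCongr (Equiv.refl (Γ ⧸ N)))
  rw [← Matrix.det_submatrix_equiv_self e]
  have h0 : ∀ δ, cosetSum N (0 : C0 p Γ) δ = 0 := fun δ => map_zero (cosetSumHom N p δ)
  have h : (matRep N p (r + t) (stabMatrix r (r + t) f)).submatrix e e =
      Matrix.fromBlocks (matRep N p r f) 0 0 1 := by
    ext (⟨i, a⟩ | ⟨i, a⟩) (⟨j, b⟩ | ⟨j, b⟩)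
    · simp [e, matRep_apply, stabMatrix]
    · have : ¬ (i : ℕ) = r + j := by omega
      simp [e, matRep_apply, stabMatrix, Fin.ext_iff, this, h0]
    · have : ¬ r + (i : ℕ) = j := by omega
      simp [e, matRep_apply, stabMatrix, Fin.ext_iff, this, h0]
    · have h1 : matRep N p t 1 (i, a) (j, b) = (1 : Matrix _ _ ℚ_[p]) (i, a) (j, b) := by
        rw [map_one]
      rw [Matrix.fromBlocks_apply₂₂, ← h1]
      simp [e, matRep_apply, stabMatrix, Fin.ext_iff, Matrix.one_apply]
  rw [h, Matrix.det_fromBlocks_zero₂₁, Matrix.det_one, mul_one]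

/-- `log det_{ℚ_p}` of the image of a `1`-unit in a finite quotient. -/
theorem padicLog_detRho_oneUnit {r : ℕ} (a : Matrix (Fin r) (Fin r) (integral p Γ)) :
    detRho N (1 + (p : ℚ_[p]) • matVal p Γ r a) ≠ 0 ∧
    (N.index : ℚ_[p])⁻¹ * padicLog (detRho N (1 + (p : ℚ_[p]) • matVal p Γ r a)) =
      cosetSum N (logSeries p (1 + (p : ℚ_[p]) • matVal p Γ r a)).trace 1 := by
  -- Coset sums do not increase the norm, so the representing matrix of `a` is integral.
  obtain ⟨h1, h2⟩ := padicLog_det_one_add_smul (p := p) (matRep N p r (matVal p Γ r a))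
    fun i j => (norm_cosetSum_le N _ _).trans (norm_matVal_le a i.1 j.1)
  rw [detRho_eq, map_add, map_one, matRep_smul]
  refine ⟨h1, ?_⟩
  rw [h2]
  have h3 := (hasSum_trace_logSeries a).map (cosetSumHom N p 1) (continuous_cosetSumHom N 1)
  have h4 : ∀ ν, logCoeff p ν * ((matRep N p r (matVal p Γ r a)) ^ (ν + 1)).trace =
      (N.index : ℚ_[p]) * cosetSumHom N p 1
        (logCoeff p ν • (matVal p Γ r a ^ (ν + 1)).trace) := fun ν => by
    rw [← map_pow, trace_matRep]
    change _ = _ * cosetSum N _ _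
    rw [cosetSum_smul]
    ring
  have h5 : (N.index : ℚ_[p]) ≠ 0 := Nat.cast_ne_zero.mpr Subgroup.FiniteIndex.index_ne_zero
  simp_rw [h4]
  rw [tsum_mul_left, inv_mul_cancel_left₀ h5]
  exact h3.tsum_eq

end Quotient

end C0

/-! ### The limit formula for `1`-units -/

section OneUnits

variable {p : ℕ} [hp : Fact p.Prime] {Γ : Type*} [Group Γ]

/-- The sum of the coefficients over `Γ_n` tends to the coefficient at the neutral element. -/
theorem C0.tendsto_cosetSum_one {S : ℕ → Subgroup Γ} [∀ n, (S n).Normal]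
    (hS : ∀ γ : Γ, γ ≠ 1 → {n : ℕ | γ ∈ S n}.Finite) (x : C0 p Γ) :
    Tendsto (fun n => C0.cosetSum (S n) x 1) atTop (𝓝 (x.coeff 1)) := by
  rw [Metric.tendsto_atTop]
  intro ε hε
  have h1 := Metric.tendsto_nhds.mp x.tendsto_zero (ε / 2) (half_pos hε)
  rw [Filter.eventually_cofinite] at h1
  -- Finitely many `γ ≠ 1` have coefficients of size at least `ε / 2`, and each lies in finitely
  -- many `S n`. Beyond all these `n`, only small terms remain besides `γ = 1`, and the ultrametric
  -- inequality bounds their sum.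
  have h3 := (h1.sdiff (t := {1})).biUnion fun γ hγ => hS γ hγ.2
  obtain ⟨M, hM⟩ := h3.bddAbove
  refine ⟨M + 1, fun n hn => ?_⟩
  rw [dist_eq_norm]
  classical
  have hsum := C0.summable_cosetInd_mul (S n) x 1
  have h4 : C0.cosetSum (S n) x 1 - x.coeff 1 =
      ∑' γ, if γ = 1 then 0 else C0.cosetInd (S n) p 1 γ * x.coeff γ := by
    rw [C0.cosetSum_eq, hsum.tsum_eq_add_tsum_ite 1]
    simp [C0.cosetInd]
  rw [h4]
  refine lt_of_le_of_lt (IsUltrametricDist.norm_tsum_le_of_forall_le_of_nonneg (half_pos hε).le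
    fun γ => ?_) (half_lt_self hε)
  split_ifs with hγ
  · simpa using (half_pos hε).le
  · by_cases hmem : γ ∈ S n
    · rw [norm_mul]
      refine (mul_le_of_le_one_left (norm_nonneg _) (C0.norm_cosetInd_le _ _ _)).trans ?_
      by_contra hcon
      have : n ≤ M := hM (Set.mem_biUnion (x := γ) (by
        exact ⟨by simpa [dist_zero_right] using (not_le.mp hcon).le, hγ⟩) hmem)
      omega
    · have : C0.cosetInd (S n) p 1 γ = 0 := if_neg fun h => hmem ((QuotientGroup.eq_one_iff γ).mp h)
      rw [this, zero_mul, norm_zero]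
      exact (half_pos hε).le

theorem isLogDetLimit_oneUnit {S : ℕ → Subgroup Γ} [∀ n, (S n).Normal] [∀ n, (S n).FiniteIndex]
    (hS : ∀ γ : Γ, γ ≠ 1 → {n : ℕ | γ ∈ S n}.Finite) {r : ℕ}
    {f : Matrix (Fin r) (Fin r) (C0 p Γ)} (hf : IsOneUnit f) :
    IsLogDetLimit S f (logDetOneUnit f) := by
  obtain ⟨a, rfl⟩ := hf
  have h := fun n => C0.padicLog_detRho_oneUnit (S n) a
  exact ⟨fun n => (h n).1, (C0.tendsto_cosetSum_one hS _).congr fun n => ((h n).2).symm⟩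

end OneUnits

/-! ### Reduction modulo `p` -/

namespace C0

section ModP

variable {p : ℕ} [hp : Fact p.Prime] {Γ : Type*} [Group Γ]

/-- The coefficients of an element of `c₀(Γ, ℤ_p)`, as elements of `ℤ_p`. -/
def intCoeff (x : integral p Γ) (γ : Γ) : ℤ_[p] := ⟨(x : C0 p Γ).coeff γ, x.2 γ⟩

theorem toZMod_eq_zero_iff (z : ℤ_[p]) : PadicInt.toZMod z = 0 ↔ ‖z‖ < 1 := by
  rw [← RingHom.mem_ker, PadicInt.ker_toZMod, IsLocalRing.mem_maximalIdeal, PadicInt.mem_nonunits]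

/-- Null coefficients are eventually divisible by `p`, so the reduction lands in the ordinary group
ring. -/
theorem finite_support_toZMod (x : integral p Γ) :
    (Function.support fun γ => PadicInt.toZMod (intCoeff x γ)).Finite := by
  have h := Metric.tendsto_nhds.mp (x : C0 p Γ).tendsto_zero 1 one_pos
  rw [Filter.eventually_cofinite] at h
  refine h.subset fun γ hγ => ?_
  rw [Function.mem_support, ne_eq, toZMod_eq_zero_iff] at hγ
  rw [Set.mem_ofPred_eq, dist_zero_right]
  exact hγ

/-- The residue field is discrete, so a convergent sum becomes an eventually constant finite one mod
`p`. -/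
theorem hasSum_toZMod {ι : Type*} {f : ι → ℤ_[p]} {a : ℤ_[p]} (h : HasSum f a) :
    ∃ t : Finset ι, ∀ s, t ⊆ s → ∑ i ∈ s, PadicInt.toZMod (f i) = PadicInt.toZMod a := by
  have h1 := (Metric.tendsto_nhds.mp h) 1 one_pos
  simp only [SummationFilter.unconditional_filter] at h1
  obtain ⟨t, ht⟩ := Filter.eventually_atTop.mp h1
  refine ⟨t, fun s hs => ?_⟩
  have := ht s hs
  rw [dist_eq_norm, ← toZMod_eq_zero_iff, map_sub, map_sum, sub_eq_zero] at this
  exact this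

/-- Reduction modulo `p` of the coefficients. -/
noncomputable def modP (p : ℕ) [Fact p.Prime] (Γ : Type*) [Group Γ] :
    integral p Γ →+* MonoidAlgebra (ZMod p) Γ where
  toFun x := .ofCoeff (Finsupp.ofSupportFinite _ (finite_support_toZMod x))
  map_zero' := by
    ext γ
    exact map_zero PadicInt.toZMod
  map_add' x y := by
    ext γ
    exact map_add PadicInt.toZMod (intCoeff x γ) (intCoeff y γ)
  map_one' := by
    classical
    ext γ
    change PadicInt.toZMod (intCoeff 1 γ) = _
    rw [MonoidAlgebra.one_def, MonoidAlgebra.coeff_single, Finsupp.single_apply]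
    by_cases h : 1 = γ
    · subst h
      rw [if_pos rfl, ← map_one PadicInt.toZMod]
      exact congrArg _ (Subtype.ext (delta_self 1))
    · rw [if_neg h, ← map_zero PadicInt.toZMod]
      exact congrArg _ (Subtype.ext (delta_ne (Ne.symm h)))
  map_mul' x y := by
    classical
    ext γ
    rw [MonoidAlgebra.coeff_mul_apply_left]
    have h1 : HasSum (fun a => intCoeff x a * intCoeff y (a⁻¹ * γ)) (intCoeff (x * y) γ) := by
      have hind : Topology.IsInducing (⇑(PadicInt.Coe.ringHom : ℤ_[p] →+* ℚ_[p])) :=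
        Topology.IsInducing.subtypeVal
      rw [← hind.hasSum_iff]
      exact (summable_conv (x : C0 p Γ) (y : C0 p Γ) γ).hasSum
    obtain ⟨t, ht⟩ := hasSum_toZMod h1
    change PadicInt.toZMod (intCoeff (x * y) γ) = _
    -- The finite set must be large enough both for the convolution mod `p` to have stabilized and
    -- to contain the support of the reduced `x`.
    rw [← ht _ (Finset.subset_union_left (s₂ := (finite_support_toZMod x).toFinset)),
      Finsupp.sum_of_support_subset (s := t ∪ (finite_support_toZMod x).toFinset)]
    · exact Finset.sum_congr rfl fun a _ => map_mul _ _ _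
    · intro a ha
      rw [Finset.mem_union, Set.Finite.mem_toFinset]
      exact Or.inr (Finsupp.mem_support_iff.mp ha)
    · intro a _
      exact zero_mul _

theorem modP_coeff (x : integral p Γ) (γ : Γ) :
    (modP p Γ x).coeff γ = PadicInt.toZMod (intCoeff x γ) := rfl

theorem modP_surjective : Function.Surjective (modP p Γ) := fun z => by
  have hint : ∀ γ, ‖((z.coeff γ).val : ℚ_[p])‖ ≤ 1 := fun γ => Padic.norm_natCast_le _
  have hz : Tendsto (fun γ => ((z.coeff γ).val : ℚ_[p])) cofinite (𝓝 0) := by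
    refine tendsto_nhds_of_eventually_eq ?_
    rw [Filter.eventually_cofinite]
    refine z.coeff.support.finite_toSet.subset fun γ hγ => ?_
    rw [Finset.mem_coe, Finsupp.mem_support_iff]
    intro h
    exact hγ (by rw [h, ZMod.val_zero, Nat.cast_zero])
  refine ⟨⟨⟨_, hz⟩, hint⟩, ?_⟩
  ext γ
  rw [modP_coeff]
  have : intCoeff ⟨⟨_, hz⟩, hint⟩ γ = ((z.coeff γ).val : ℤ_[p]) :=
    Subtype.ext (PadicInt.coe_natCast _).symm
  rw [this, map_natCast, ZMod.natCast_zmod_val]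

theorem exists_eq_nsmul_of_modP_eq_zero {x : integral p Γ} (hx : modP p Γ x = 0) :
    ∃ y : integral p Γ, x = p • y := by
  have hp0 : (p : ℚ_[p]) ≠ 0 := by exact_mod_cast hp.out.ne_zero
  refine ⟨⟨(p : ℚ_[p])⁻¹ • (x : C0 p Γ), fun γ => ?_⟩, Subtype.ext ?_⟩
  · have h1 : PadicInt.toZMod (intCoeff x γ) = 0 := by
      rw [← modP_coeff, hx]
      rfl
    rw [toZMod_eq_zero_iff, PadicInt.norm_lt_one_iff_dvd] at h1
    obtain ⟨z, hz⟩ := h1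
    have h2 : (x : C0 p Γ).coeff γ = p * (z : ℚ_[p]) := by
      have := congrArg (fun w : ℤ_[p] => (w : ℚ_[p])) hz
      push_cast at this
      exact this
    rw [coeff_smul, h2, inv_mul_cancel_left₀ hp0]
    exact z.norm_le_one
  · change (x : C0 p Γ) = p • ((p : ℚ_[p])⁻¹ • (x : C0 p Γ))
    rw [← Nat.cast_smul_eq_nsmul ℚ_[p], smul_inv_smul₀ hp0]

theorem modP_integralOf (γ : Γ) : modP p Γ (integralOf p Γ γ) = MonoidAlgebra.of (ZMod p) Γ γ := by
  classical
  ext a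
  rw [modP_coeff, MonoidAlgebra.of_apply, MonoidAlgebra.coeff_single, Finsupp.single_apply]
  by_cases h : γ = a
  · subst h
    rw [if_pos rfl, ← map_one PadicInt.toZMod]
    exact congrArg _ (Subtype.ext (delta_self γ))
  · rw [if_neg h, ← map_zero PadicInt.toZMod]
    exact congrArg _ (Subtype.ext (delta_ne (Ne.symm h)))

/-- Reduction modulo `p` of matrices. -/
noncomputable abbrev matModP (p : ℕ) [Fact p.Prime] (Γ : Type*) [Group Γ] (r : ℕ) :
    Matrix (Fin r) (Fin r) (integral p Γ) →+*
      Matrix (Fin r) (Fin r) (MonoidAlgebra (ZMod p) Γ) := (modP p Γ).mapMatrix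

theorem matModP_surjective (r : ℕ) : Function.Surjective (matModP p Γ r) := fun z =>
  ⟨Matrix.of fun i j => (modP_surjective (z i j)).choose,
    Matrix.ext fun i j => (modP_surjective (z i j)).choose_spec⟩

theorem exists_eq_one_add_of_matModP_eq_one {r : ℕ} {a : Matrix (Fin r) (Fin r) (integral p Γ)}
    (ha : matModP p Γ r a = 1) : ∃ b, a = 1 + p • b := by
  have h : ∀ i j, ∃ y, (a - 1) i j = p • y := fun i j => by
    refine exists_eq_nsmul_of_modP_eq_zero ?_
    have : matModP p Γ r (a - 1) i j = 0 := by rw [map_sub, ha, map_one, sub_self, Matrix.zero_apply]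
    exact this
  choose b hb using h
  refine ⟨Matrix.of b, ?_⟩
  rw [← sub_eq_iff_eq_add']
  exact Matrix.ext hb

/-- If `b` lifts the inverse, then `a b` and `b a` are `1` mod `p`, hence units by the geometric
series, so `a` has a right and a left inverse. -/
theorem isUnit_of_isUnit_matModP {r : ℕ} {a : Matrix (Fin r) (Fin r) (integral p Γ)}
    (ha : IsUnit (matModP p Γ r a)) : IsUnit a := by
  obtain ⟨u, hu⟩ := ha
  obtain ⟨b, hb⟩ := matModP_surjective r (↑u⁻¹ : Matrix (Fin r) (Fin r) (MonoidAlgebra (ZMod p) Γ))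
  obtain ⟨c, hc⟩ := exists_eq_one_add_of_matModP_eq_one (a := a * b)
    (by rw [map_mul, hb, ← hu, Units.mul_inv])
  obtain ⟨d, hd⟩ := exists_eq_one_add_of_matModP_eq_one (a := b * a)
    (by rw [map_mul, hb, ← hu, Units.inv_mul])
  obtain ⟨v, hv⟩ := isUnit_one_add_prime_nsmul c
  obtain ⟨w, hw⟩ := isUnit_one_add_prime_nsmul d
  rw [isUnit_iff_exists_and_exists]
  exact ⟨⟨b * (↑v⁻¹ : Matrix (Fin r) (Fin r) (integral p Γ)), by rw [← mul_assoc, hc, ← hv, Units.mul_inv]⟩,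
    ⟨(↑w⁻¹ : Matrix (Fin r) (Fin r) (integral p Γ)) * b, by rw [mul_assoc, hd, ← hw, Units.inv_mul]⟩⟩

theorem units_map_matModP_surjective (r : ℕ) :
    Function.Surjective (Units.map (matModP p Γ r).toMonoidHom) := fun z => by
  obtain ⟨a, ha⟩ := matModP_surjective r (z : Matrix (Fin r) (Fin r) (MonoidAlgebra (ZMod p) Γ))
  obtain ⟨u, hu⟩ := isUnit_of_isUnit_matModP (a := a) (by rw [ha]; exact z.isUnit)
  refine ⟨u, Units.ext ?_⟩
  change matModP p Γ r ↑u = z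
  rw [hu, ha]

theorem isOneUnit_glVal_of_matModP_eq_one {r : ℕ}
    {u : (Matrix (Fin r) (Fin r) (integral p Γ))ˣ}
    (hu : Units.map (matModP p Γ r).toMonoidHom u = 1) : IsOneUnit (glVal u) := by
  obtain ⟨b, hb⟩ := exists_eq_one_add_of_matModP_eq_one (congrArg Units.val hu)
  refine ⟨b, ?_⟩
  change matVal p Γ r (u : Matrix (Fin r) (Fin r) (integral p Γ)) = _ + _ • matVal p Γ r b
  rw [prime_smul_matVal, ← map_one (matVal p Γ r), ← map_add, hb]

end ModP

end C0

/-! ### Reduction modulo `p` on `GL_∞` -/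

section GLInf

variable {p : ℕ} [hp : Fact p.Prime] {Γ : Type*} [Group Γ]

theorem stabMatrix_map {R R' : Type*} [Ring R] [Ring R'] (φ : R →+* R') (r s : ℕ)
    (a : Matrix (Fin r) (Fin r) R) :
    (stabMatrix r s a).map φ = stabMatrix r s (a.map φ) := by
  ext i j
  simp only [stabMatrix, Matrix.map_apply, Matrix.of_apply]
  split_ifs <;> simp

theorem toGLInf_stabGL {R : Type*} [Ring R] {r s : ℕ} (h : r ≤ s)
    (a : (Matrix (Fin r) (Fin r) R)ˣ) : toGLInf R s (stabGL R h a) = toGLInf R r a :=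
  (DirectLimit.eq_of_le (F := fun r : ℕ => (Matrix (Fin r) (Fin r) R)ˣ)
    (f := fun _ _ h => stabGL R h) ⟨r, a⟩ s h).symm

theorem exists_toGLInf_eq {R : Type*} [Ring R] (x : GLInf R) : ∃ r a, toGLInf R r a = x := by
  obtain ⟨r, a, h⟩ := DirectLimit.exists_eq_mk (F := fun r : ℕ => (Matrix (Fin r) (Fin r) R)ˣ)
    (f := fun _ _ h => stabGL R h) x
  exact ⟨r, a, h.symm⟩

theorem exists_toGLInf_eq₂ {R : Type*} [Ring R] (x y : GLInf R) :
    ∃ r a b, toGLInf R r a = x ∧ toGLInf R r b = y := by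
  obtain ⟨r, a, b, h1, h2⟩ := DirectLimit.exists_eq_mk₂ (F := fun r : ℕ => (Matrix (Fin r) (Fin r) R)ˣ)
    (f := fun _ _ h => stabGL R h) x y
  exact ⟨r, a, b, h1.symm, h2.symm⟩

theorem exists_stabGL_eq_one {R : Type*} [Ring R] {r : ℕ} {a : (Matrix (Fin r) (Fin r) R)ˣ}
    (h : toGLInf R r a = 1) : ∃ (s : ℕ) (hrs : r ≤ s), stabGL R hrs a = 1 :=
  (DirectLimit.exists_eq_one (G := fun r : ℕ => (Matrix (Fin r) (Fin r) R)ˣ)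
    (f := fun _ _ h => stabGL R h) ⟨r, a⟩).mp h

/-- A compatible family of homomorphisms on the groups `GL_r(R)` induces one on `GL_∞(R)`. -/
noncomputable def GLInf.lift {R H : Type*} [Ring R] [Monoid H]
    (φ : ∀ r : ℕ, (Matrix (Fin r) (Fin r) R)ˣ →* H)
    (hφ : ∀ (r s : ℕ) (h : r ≤ s) (a), φ s (stabGL R h a) = φ r a) : GLInf R →* H where
  toFun := DirectLimit.lift (fun _ _ h => stabGL R h) (fun r a => φ r a)
    fun r s h a => (hφ r s h a).symm
  map_one' := by
    rw [← map_one (toGLInf R 0)]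
    exact map_one (φ 0)
  map_mul' x y := by
    obtain ⟨r, a, b, rfl, rfl⟩ := exists_toGLInf_eq₂ x y
    rw [← map_mul]
    exact map_mul (φ r) a b

/-- The functoriality of `GL_∞`. -/
noncomputable def GLInf.map {R R' : Type*} [Ring R] [Ring R'] (φ : R →+* R') :
    GLInf R →* GLInf R' :=
  GLInf.lift (fun r => (toGLInf R' r).comp (Units.map φ.mapMatrix.toMonoidHom)) fun r s h a => by
    have : Units.map φ.mapMatrix.toMonoidHom (stabGL R h a) =
        stabGL R' h (Units.map φ.mapMatrix.toMonoidHom a) :=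
      Units.ext (stabMatrix_map φ r s a.val)
    rw [MonoidHom.comp_apply, this, toGLInf_stabGL, MonoidHom.comp_apply]

theorem GLInf.map_toGLInf {R R' : Type*} [Ring R] [Ring R'] (φ : R →+* R') (r : ℕ)
    (a : (Matrix (Fin r) (Fin r) R)ˣ) :
    GLInf.map φ (toGLInf R r a) = toGLInf R' r (Units.map φ.mapMatrix.toMonoidHom a) := rfl

theorem GLInf.map_modP_surjective :
    Function.Surjective (GLInf.map (C0.modP p Γ)) := fun y => by
  obtain ⟨r, b, rfl⟩ := exists_toGLInf_eq y
  obtain ⟨a, rfl⟩ := C0.units_map_matModP_surjective r b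
  exact ⟨toGLInf _ r a, rfl⟩

/-- The image of `a ∈ Rˣ = GL_1(R)` in `GL_∞(R)`. -/
noncomputable def unitsToGLInf (R : Type*) [Ring R] : Rˣ →* GLInf R :=
  (toGLInf R 1).comp (Units.map (Matrix.scalar (Fin 1)).toMonoidHom)

theorem GLInf.map_unitsToGLInf {R R' : Type*} [Ring R] [Ring R'] (φ : R →+* R') (u : Rˣ) :
    GLInf.map φ (unitsToGLInf R u) = unitsToGLInf R' (Units.map φ.toMonoidHom u) := by
  rw [unitsToGLInf, MonoidHom.comp_apply, GLInf.map_toGLInf, unitsToGLInf, MonoidHom.comp_apply]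
  congr 1
  refine Units.ext ?_
  refine Matrix.ext fun i j => ?_
  obtain rfl := Subsingleton.elim i j
  simp

/-- If `Wh^{𝔽_p}(Γ)` is torsion, then `GL_∞(c₀(Γ, ℤ_p))` is generated, up to roots, by the
`1`-units, the group `Γ` and the commutators. -/
theorem mem_of_isMulTorsion_whiteheadGroup (hWh : IsMulTorsion (WhiteheadGroup (ZMod p) Γ))
    (P : Subgroup (GLInf (C0.integral p Γ)))
    (hone : ∀ (r : ℕ) (u : (Matrix (Fin r) (Fin r) (C0.integral p Γ))ˣ), IsOneUnit (glVal u) →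
      toGLInf _ r u ∈ P)
    (hgroup : ∀ γ : Γ, unitsToGLInf _ ((C0.integralOf p Γ).toHomUnits γ) ∈ P)
    (hcomm : commutator (GLInf (C0.integral p Γ)) ≤ P)
    (hroot : ∀ x (n : ℕ), 0 < n → x ^ n ∈ P → x ∈ P) (x : GLInf (C0.integral p Γ)) : x ∈ P := by
  set φ := GLInf.map (C0.modP p Γ)
  -- Torsion gives `n` such that `x ^ n` agrees mod `p`, up to commutators, with some `γ ∈ Γ`.
  obtain ⟨n, hn, hxn⟩ := isOfFinOrder_iff_pow_eq_one.mp
    (hWh (QuotientGroup.mk (Abelianization.of (φ x))))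
  refine hroot x n hn ?_
  rw [← QuotientGroup.mk_pow, QuotientGroup.eq_one_iff] at hxn
  obtain ⟨γ, hγ⟩ := hxn
  set g := unitsToGLInf _ ((C0.integralOf p Γ).toHomUnits γ)
  have hg : Abelianization.of (φ g) = Abelianization.of (φ x) ^ n := by
    rw [← hγ, GLInf.map_unitsToGLInf]
    have : Units.map (C0.modP p Γ).toMonoidHom ((C0.integralOf p Γ).toHomUnits γ) =
        (MonoidAlgebra.of (ZMod p) Γ).toHomUnits γ := Units.ext (C0.modP_integralOf γ)
    rw [this]
    rfl
  have h1 : φ (g⁻¹ * x ^ n) ∈ commutator (GLInf (MonoidAlgebra (ZMod p) Γ)) := by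
    rw [← Abelianization.ker_of, MonoidHom.mem_ker, map_mul, map_inv, map_pow, map_mul, map_inv,
      map_pow, hg, inv_mul_cancel]
  -- By surjectivity of the reduction, the commutator error lifts to characteristic zero.
  have h2 : commutator (GLInf (MonoidAlgebra (ZMod p) Γ)) =
      (commutator (GLInf (C0.integral p Γ))).map φ := by
    rw [commutator_def, commutator_def, Subgroup.map_commutator,
      Subgroup.map_top_of_surjective φ GLInf.map_modP_surjective]
  rw [h2] at h1
  obtain ⟨c, hc, hcφ⟩ := h1
  have h3 : φ (c⁻¹ * (g⁻¹ * x ^ n)) = 1 := by rw [map_mul, map_inv, hcφ, inv_mul_cancel]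
  have h4 : c⁻¹ * (g⁻¹ * x ^ n) ∈ P := by
    obtain ⟨r, u, hu⟩ := exists_toGLInf_eq (c⁻¹ * (g⁻¹ * x ^ n))
    rw [← hu] at h3 ⊢
    -- Triviality in the direct limit provides a size at which the reduced matrix is the identity;
    -- there the lift is a `1`-unit.
    obtain ⟨s, hrs, hs⟩ := exists_stabGL_eq_one (a := Units.map
      (C0.matModP p Γ r).toMonoidHom u) h3
    rw [← toGLInf_stabGL hrs]
    refine hone s _ (C0.isOneUnit_glVal_of_matModP_eq_one ?_)
    rw [← hs]
    exact Units.ext (stabMatrix_map (C0.modP p Γ) r s u.val)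
  have h5 : x ^ n = g * (c * (c⁻¹ * (g⁻¹ * x ^ n))) := by group
  rw [h5]
  exact P.mul_mem (hgroup γ) (P.mul_mem (hcomm hc) h4)

end GLInf

/-! ### Limits of normalized logarithmic determinants -/

section LimitHom

variable {p : ℕ} [hp : Fact p.Prime]

/-- The elements at which a sequence of homomorphisms to `ℚ_p` converges. -/
def convergenceSubgroup {G : Type*} [Group G] (s : G →* Multiplicative (ℕ → ℚ_[p])) :
    Subgroup G where
  carrier := {x | ∃ l, Tendsto (s x).toAdd atTop (𝓝 l)}
  one_mem' := ⟨0, by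
    rw [map_one]
    exact tendsto_const_nhds⟩
  mul_mem' := by
    rintro x y ⟨l, hl⟩ ⟨m, hm⟩
    refine ⟨l + m, ?_⟩
    rw [map_mul]
    exact hl.add hm
  inv_mem' := by
    rintro x ⟨l, hl⟩
    refine ⟨-l, ?_⟩
    rw [map_inv]
    exact hl.neg

theorem exists_limit_hom {G : Type*} [Group G] (s : G →* Multiplicative (ℕ → ℚ_[p]))
    (h : ∀ x, x ∈ convergenceSubgroup s) :
    ∃ L : G →* Multiplicative ℚ_[p], ∀ x, Tendsto (s x).toAdd atTop (𝓝 (L x).toAdd) := by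
  choose l hl using h
  refine ⟨MonoidHom.mk' (fun x => Multiplicative.ofAdd (l x)) fun x y => ?_, hl⟩
  refine congrArg Multiplicative.ofAdd (tendsto_nhds_unique (hl (x * y)) ?_)
  rw [map_mul]
  exact (hl x).add (hl y)

/-- The sequence at `x ^ n` is `n` times that at `x`, and `n` is invertible in `ℚ_p`. -/
theorem convergenceSubgroup_of_pow {G : Type*} [Group G] (s : G →* Multiplicative (ℕ → ℚ_[p]))
    {x : G} {n : ℕ} (hn : 0 < n) (h : x ^ n ∈ convergenceSubgroup s) :
    x ∈ convergenceSubgroup s := by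
  obtain ⟨l, hl⟩ := h
  refine ⟨(n : ℚ_[p])⁻¹ * l, (hl.const_mul (n : ℚ_[p])⁻¹).congr fun k => ?_⟩
  have hn0 : (n : ℚ_[p]) ≠ 0 := Nat.cast_ne_zero.mpr hn.ne'
  rw [map_pow, toAdd_pow, Pi.smul_apply, nsmul_eq_mul, inv_mul_cancel_left₀ hn0]

theorem Multiplicative.pow_left_injective_padic {a b : Multiplicative ℚ_[p]} {n : ℕ} (hn : 0 < n)
    (h : a ^ n = b ^ n) : a = b := by
  have h1 : (n : ℚ_[p]) * a.toAdd = n * b.toAdd := by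
    have := congrArg Multiplicative.toAdd h
    rwa [toAdd_pow, toAdd_pow, nsmul_eq_mul, nsmul_eq_mul] at this
  exact Multiplicative.toAdd.injective
    (mul_left_cancel₀ (Nat.cast_ne_zero.mpr hn.ne' : (n : ℚ_[p]) ≠ 0) h1)

end LimitHom

section LogDetSequence

variable {p : ℕ} [hp : Fact p.Prime] {Γ : Type*} [Group Γ]
variable (S : ℕ → Subgroup Γ) [∀ n, (S n).Normal] [∀ n, (S n).FiniteIndex]

/-- The sequence `(Γ : Γ_n)⁻¹ log_p det(ρ_{f^(n)})` as a homomorphism on `GL_r(c₀(Γ))`. -/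
noncomputable def logDetSeq (p : ℕ) [Fact p.Prime] (r : ℕ) :
    (Matrix (Fin r) (Fin r) (C0 p Γ))ˣ →* Multiplicative (ℕ → ℚ_[p]) :=
  MonoidHom.mk' (fun f => Multiplicative.ofAdd fun n =>
    ((S n).index : ℚ_[p])⁻¹ * padicLog (detRho (S n) f.val)) fun f g => by
    refine congrArg Multiplicative.ofAdd (funext fun n => ?_)
    rw [Units.val_mul, C0.detRho_mul, padicLog_mul (C0.detRho_ne_zero_of_isUnit (S n) f.isUnit)
      (C0.detRho_ne_zero_of_isUnit (S n) g.isUnit), mul_add]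
    rfl

theorem logDetSeq_apply {r : ℕ} (f : (Matrix (Fin r) (Fin r) (C0 p Γ))ˣ) (n : ℕ) :
    (logDetSeq S p r f).toAdd n = ((S n).index : ℚ_[p])⁻¹ * padicLog (detRho (S n) f.val) := rfl

theorem isLogDetLimit_iff {r : ℕ} (f : (Matrix (Fin r) (Fin r) (C0 p Γ))ˣ) (x : ℚ_[p]) :
    IsLogDetLimit S f.val x ↔ Tendsto (logDetSeq S p r f).toAdd atTop (𝓝 x) :=
  ⟨fun h => h.2, fun h => ⟨fun n => C0.detRho_ne_zero_of_isUnit (S n) f.isUnit, h⟩⟩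

/-- Extension of scalars `GL_r(c₀(Γ, ℤ_p)) → GL_r(c₀(Γ))`. -/
noncomputable def glValHom (p : ℕ) [Fact p.Prime] (Γ : Type*) [Group Γ] (r : ℕ) :
    (Matrix (Fin r) (Fin r) (C0.integral p Γ))ˣ →* (Matrix (Fin r) (Fin r) (C0 p Γ))ˣ :=
  Units.map (C0.matVal p Γ r).toMonoidHom

theorem glValHom_val {r : ℕ} (f : (Matrix (Fin r) (Fin r) (C0.integral p Γ))ˣ) :
    (glValHom p Γ r f).val = glVal f := rfl

/-- The sequence of normalized logarithmic determinants on `GL_∞(c₀(Γ, ℤ_p))`. -/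
noncomputable def logDetSeqGLInf (p : ℕ) [Fact p.Prime] :
    GLInf (C0.integral p Γ) →* Multiplicative (ℕ → ℚ_[p]) :=
  GLInf.lift (fun r => (logDetSeq S p r).comp (glValHom p Γ r)) fun r s h a => by
    refine Multiplicative.toAdd.injective (funext fun n => ?_)
    have : (glValHom p Γ s (stabGL _ h a)).val = stabMatrix r s (glValHom p Γ r a).val :=
      stabMatrix_map (C0.integral p Γ).subtype r s a.val
    rw [MonoidHom.comp_apply, MonoidHom.comp_apply, logDetSeq_apply, logDetSeq_apply, this,
      C0.detRho_stabMatrix (S n) h]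

theorem logDetSeqGLInf_toGLInf {r : ℕ} (f : (Matrix (Fin r) (Fin r) (C0.integral p Γ))ˣ) :
    logDetSeqGLInf S p (toGLInf _ r f) = logDetSeq S p r (glValHom p Γ r f) := rfl

theorem C0.matRep_scalar_delta_of_mem (N : Subgroup Γ) [N.Normal] [N.FiniteIndex] {γ : Γ}
    (h : γ ∈ N) : C0.matRep N p 1 (Matrix.scalar (Fin 1) (C0.of p Γ γ)) = 1 := by
  rw [← map_one (C0.matRep N p 1), ← map_one (Matrix.scalar (Fin 1))]
  refine Matrix.ext fun i j => ?_
  rw [C0.matRep_apply, C0.matRep_apply, Subsingleton.elim j.1 i.1, Matrix.scalar_apply,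
    Matrix.scalar_apply, Matrix.diagonal_apply_eq, Matrix.diagonal_apply_eq]
  refine (C0.cosetSum_delta N γ _).trans (Eq.trans ?_ (C0.cosetSum_delta N 1 _).symm)
  rw [(QuotientGroup.eq_one_iff γ).mpr h, QuotientGroup.mk_one]

/-- `γ ^ (Γ : N)` lies in `N` and acts trivially, so the determinant is a root of unity, which
`log_p` kills. -/
theorem C0.padicLog_detRho_scalar_delta (N : Subgroup Γ) [N.Normal] [N.FiniteIndex] (γ : Γ) :
    padicLog (detRho N (Matrix.scalar (Fin 1) (C0.of p Γ γ))) = 0 := by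
  have hu : IsUnit (Matrix.scalar (Fin 1) (C0.of p Γ γ)) :=
    ((Group.isUnit γ).map (C0.of p Γ)).map (Matrix.scalar (Fin 1))
  have h0 := C0.detRho_ne_zero_of_isUnit N hu
  have h1 : detRho N (Matrix.scalar (Fin 1) (C0.of p Γ γ)) ^ N.index = 1 := by
    rw [C0.detRho_eq, ← Matrix.det_pow, ← map_pow, ← map_pow, ← map_pow,
      C0.matRep_scalar_delta_of_mem N (N.pow_index_mem γ), Matrix.det_one]
  have h2 := padicLog_pow h0 N.index
  rw [h1, padicLog_one, eq_comm, mul_eq_zero] at h2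
  exact h2.resolve_left (Nat.cast_ne_zero.mpr Subgroup.FiniteIndex.index_ne_zero)

theorem logDetSeqGLInf_group (γ : Γ) :
    logDetSeqGLInf S p (unitsToGLInf _ ((C0.integralOf p Γ).toHomUnits γ)) = 1 := by
  refine Multiplicative.toAdd.injective (funext fun n => ?_)
  have : glVal (Units.map (Matrix.scalar (Fin 1)).toMonoidHom ((C0.integralOf p Γ).toHomUnits γ)) =
      Matrix.scalar (Fin 1) (C0.of p Γ γ) := by
    refine Matrix.ext fun i j => ?_
    obtain rfl := Subsingleton.elim i j
    simp [glVal, C0.integralOf]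
    rfl
  rw [unitsToGLInf, MonoidHom.comp_apply, logDetSeqGLInf_toGLInf, logDetSeq_apply, glValHom_val,
    this, C0.padicLog_detRho_scalar_delta, mul_zero]
  rfl

/-! ### The logarithmic determinant on `K₁` -/

/-- The equalizer of two candidates contains the generators and is closed under roots because `ℚ_p`
is torsion-free. -/
theorem isLogDetK1_unique (hWh : IsMulTorsion (WhiteheadGroup (ZMod p) Γ))
    {L L' : K1 (C0.integral p Γ) →* Multiplicative ℚ_[p]} (hL : IsLogDetK1 p Γ L)
    (hL' : IsLogDetK1 p Γ L') : L = L' := by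
  refine Abelianization.hom_ext _ _ (MonoidHom.ext fun x => ?_)
  refine mem_of_isMulTorsion_whiteheadGroup hWh
    ((L.comp Abelianization.of).eqLocus (L'.comp Abelianization.of))
    (fun r u hu => ?_) (fun γ => ?_) (fun c hc => ?_) (fun y n hn hy => ?_) x
  · exact Multiplicative.toAdd.injective ((hL.oneUnit r u hu).trans (hL'.oneUnit r u hu).symm)
  · exact Multiplicative.toAdd.injective ((hL.group γ).trans (hL'.group γ).symm)
  · rw [← Abelianization.ker_of, MonoidHom.mem_ker] at hc
    change L (Abelianization.of c) = L' (Abelianization.of c)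
    rw [hc, map_one, map_one]
  · refine Multiplicative.pow_left_injective_padic hn ?_
    rw [← map_pow, ← map_pow]
    exact hy

/-- The homomorphism is constructed as the limit, so existence and the limit formula are proved
together. -/
theorem exists_isLogDetK1 (hS : ∀ γ : Γ, γ ≠ 1 → {n : ℕ | γ ∈ S n}.Finite)
    (hWh : IsMulTorsion (WhiteheadGroup (ZMod p) Γ)) :
    ∃ L, IsLogDetK1 p Γ L ∧
      ∀ (r : ℕ) (f : (Matrix (Fin r) (Fin r) (C0.integral p Γ))ˣ),
        IsLogDetLimit S (glVal f) (logDetGL L f) := by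
  have hone : ∀ (r : ℕ) (u : (Matrix (Fin r) (Fin r) (C0.integral p Γ))ˣ), IsOneUnit (glVal u) →
      Tendsto (logDetSeqGLInf S p (toGLInf _ r u)).toAdd atTop (𝓝 (logDetOneUnit (glVal u))) :=
    fun r u hu => (isLogDetLimit_oneUnit hS hu).2
  obtain ⟨L₀, hL₀⟩ := exists_limit_hom (logDetSeqGLInf S p)
    (mem_of_isMulTorsion_whiteheadGroup hWh (convergenceSubgroup (logDetSeqGLInf S p))
      (fun r u hu => ⟨_, hone r u hu⟩)
      (fun γ => ⟨0, by
        rw [logDetSeqGLInf_group]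
        exact tendsto_const_nhds⟩)
      (fun c hc => ⟨0, by
        rw [Abelianization.commutator_subset_ker _ hc]
        exact tendsto_const_nhds⟩)
      fun _ _ hn hx => convergenceSubgroup_of_pow _ hn hx)
  refine ⟨Abelianization.lift L₀, ⟨fun r u hu => ?_, fun γ => ?_⟩, fun r f => ?_⟩
  · exact tendsto_nhds_unique (hL₀ (toGLInf _ r u)) (hone r u hu)
  · have h := hL₀ (unitsToGLInf _ ((C0.integralOf p Γ).toHomUnits γ))
    rw [logDetSeqGLInf_group] at h
    exact tendsto_nhds_unique h tendsto_const_nhds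
  · exact (isLogDetLimit_iff S (glValHom p Γ r f) _).mpr (hL₀ (toGLInf _ r f))

end LogDetSequence

/-! ### Units of `c₀(Γ)` -/

section Units

variable {p : ℕ} [hp : Fact p.Prime] {Γ : Type*} [Group Γ]

theorem C0.norm_one_eq : ‖(1 : C0 p Γ)‖ = 1 := by
  refine le_antisymm (C0.norm_integral_le (1 : C0.integral p Γ)) ?_
  have := C0.norm_coeff_le (1 : C0 p Γ) 1
  rwa [show (1 : C0 p Γ).coeff 1 = 1 from C0.delta_self 1, norm_one] at this

theorem C0.modP_ne_zero {x : C0.integral p Γ} (hx : (p : ℝ)⁻¹ < ‖(x : C0 p Γ)‖) :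
    C0.modP p Γ x ≠ 0 := by
  intro h
  obtain ⟨y, rfl⟩ := C0.exists_eq_nsmul_of_modP_eq_zero h
  have h1 : ((p • y : C0.integral p Γ) : C0 p Γ) = (p : ℚ_[p]) • (y : C0 p Γ) := by
    rw [Nat.cast_smul_eq_nsmul]
    rfl
  rw [h1, norm_smul, Padic.norm_p] at hx
  exact absurd hx (not_lt.mpr (mul_le_of_le_one_right (by positivity) (C0.norm_integral_le y)))

/-- Every non-zero element becomes integral and non-zero modulo `p` after scaling. -/
theorem C0.exists_zpow_smul {f : C0 p Γ} (hf : f ≠ 0) :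
    ∃ (k : ℤ) (x : C0.integral p Γ), (x : C0 p Γ) = (p : ℚ_[p]) ^ k • f ∧ C0.modP p Γ x ≠ 0 := by
  have hp1 : (1 : ℝ) < p := by exact_mod_cast hp.out.one_lt
  have hp0 : (0 : ℝ) < p := one_pos.trans hp1
  -- Here `p ^ n < ‖f‖ ≤ p ^ (n + 1)`, so scaling by `p ^ (n + 1)` brings the norm into `(p⁻¹, 1]`:
  -- integral, but not divisible by `p`.
  obtain ⟨n, hn1, hn2⟩ := exists_mem_Ioc_zpow (norm_pos_iff.mpr hf) hp1
  have hnorm : ‖(p : ℚ_[p]) ^ (n + 1) • f‖ = (p : ℝ) ^ (-(n + 1)) * ‖f‖ := by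
    rw [norm_smul, norm_zpow, Padic.norm_p, inv_zpow']
  refine ⟨n + 1, ⟨(p : ℚ_[p]) ^ (n + 1) • f, C0.mem_integral_iff.mpr ?_⟩, rfl, C0.modP_ne_zero ?_⟩
  · rw [hnorm]
    calc (p : ℝ) ^ (-(n + 1)) * ‖f‖ ≤ (p : ℝ) ^ (-(n + 1)) * (p : ℝ) ^ (n + 1) := by gcongr
      _ = 1 := by rw [← zpow_add₀ hp0.ne', neg_add_cancel, zpow_zero]
  · rw [hnorm]
    calc (p : ℝ)⁻¹ = (p : ℝ) ^ (-(n + 1)) * (p : ℝ) ^ n := by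
          rw [← zpow_add₀ hp0.ne', ← zpow_neg_one]
          congr 1
          ring
      _ < (p : ℝ) ^ (-(n + 1)) * ‖f‖ := by gcongr

theorem C0.natCast_eq_smul_one : ((p : ℕ) : C0 p Γ) = (p : ℚ_[p]) • (1 : C0 p Γ) := by
  rw [Nat.cast_smul_eq_nsmul, nsmul_eq_mul, mul_one]

/-- The unit `p` of `c₀(Γ)`. -/
noncomputable def C0.primeUnit (p : ℕ) [hp : Fact p.Prime] (Γ : Type*) [Group Γ] : (C0 p Γ)ˣ :=
  Units.map (algebraMap ℚ_[p] (C0 p Γ)).toMonoidHom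
    (Units.mk0 (p : ℚ_[p]) (Nat.cast_ne_zero.mpr hp.out.ne_zero))

theorem C0.primeUnit_val : (C0.primeUnit p Γ : C0 p Γ) = (p : C0 p Γ) :=
  map_natCast (algebraMap ℚ_[p] (C0 p Γ)) p

theorem C0.primeUnit_zpow_val (k : ℤ) :
    ((C0.primeUnit p Γ ^ k : (C0 p Γ)ˣ) : C0 p Γ) = (p : ℚ_[p]) ^ k • (1 : C0 p Γ) := by
  rw [C0.primeUnit, ← map_zpow, ← Algebra.algebraMap_eq_smul_one]
  change algebraMap ℚ_[p] (C0 p Γ) ((Units.mk0 (p : ℚ_[p]) _ ^ k : ℚ_[p]ˣ) : ℚ_[p]) = _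
  rw [Units.val_zpow_eq_zpow_val, Units.val_mk0]

/-- If `𝔽_p Γ` has no zero divisors, then `c₀(Γ)ˣ = p^ℤ × c₀(Γ, ℤ_p)ˣ`. -/
theorem C0.exists_primeUnit_zpow_mul [NoZeroDivisors (MonoidAlgebra (ZMod p) Γ)] (f : (C0 p Γ)ˣ) :
    ∃ (k : ℤ) (u : (C0.integral p Γ)ˣ),
      f = C0.primeUnit p Γ ^ k * Units.map (C0.integral p Γ).subtype.toMonoidHom u := by
  have hp0 : (p : ℚ_[p]) ≠ 0 := Nat.cast_ne_zero.mpr hp.out.ne_zero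
  have : Nontrivial (C0 p Γ) := ⟨⟨1, 0, fun h => by
    have := C0.norm_one_eq (p := p) (Γ := Γ)
    rw [h, norm_zero] at this
    exact zero_ne_one this⟩⟩
  obtain ⟨k, x, hx, hx0⟩ := C0.exists_zpow_smul f.ne_zero
  obtain ⟨m, y, hy, hy0⟩ := C0.exists_zpow_smul f⁻¹.ne_zero
  -- Scaling `f` and `f⁻¹` to `x` and `y` leaves `x y = p ^ (k + m)`. Integrality gives `k + m ≥ 0`;
  -- a positive exponent would make the product of the non-zero reductions vanish. So `k + m = 0`,
  -- and `x` is a unit of `A` with inverse `y`.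
  have hxy : (x : C0 p Γ) * y = (p : ℚ_[p]) ^ (k + m) • 1 := by
    rw [hx, hy, smul_mul_smul_comm, Units.mul_inv, zpow_add₀ hp0]
  have hyx : (y : C0 p Γ) * x = (p : ℚ_[p]) ^ (k + m) • 1 := by
    rw [hx, hy, smul_mul_smul_comm, Units.inv_mul, zpow_add₀ hp0, mul_comm]
  have hprod : C0.modP p Γ (x * y) ≠ 0 := by
    rw [map_mul]
    exact mul_ne_zero hx0 hy0
  have hle : 0 ≤ k + m := by
    have h1 := C0.norm_integral_le (x * y)
    rw [Subring.coe_mul, hxy, norm_smul, C0.norm_one_eq, mul_one, Padic.norm_p_zpow,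
      ← zpow_zero (p : ℝ), zpow_le_zpow_iff_right₀ (by exact_mod_cast hp.out.one_lt)] at h1
    linarith
  have hkm : k + m = 0 := by
    obtain ⟨j, hj⟩ := Int.eq_ofNat_of_zero_le hle
    rcases j with _ | j
    · exact hj
    · refine absurd ?_ hprod
      have h2 : x * y = (p : C0.integral p Γ) ^ (j + 1) := by
        refine Subtype.ext ?_
        rw [Subring.coe_mul, hxy, hj, zpow_natCast,
          Subring.coe_pow, Subring.coe_natCast, C0.natCast_eq_smul_one, smul_pow,
          one_pow]
      have h3 : ((p : ℕ) : MonoidAlgebra (ZMod p) Γ) = 0 := by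
        rw [← map_natCast (algebraMap (ZMod p) (MonoidAlgebra (ZMod p) Γ)), CharP.cast_eq_zero,
          map_zero]
      rw [h2, map_pow, map_natCast, h3, zero_pow (Nat.succ_ne_zero j)]
  rw [hkm, zpow_zero, one_smul] at hxy hyx
  refine ⟨-k, ⟨x, y, Subtype.ext hxy, Subtype.ext hyx⟩, Units.ext ?_⟩
  rw [Units.val_mul, C0.primeUnit_zpow_val]
  change (f : C0 p Γ) = _ * (x : C0 p Γ)
  rw [hx, smul_one_mul, smul_smul, ← zpow_add₀ hp0, neg_add_cancel, zpow_zero, one_smul]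

theorem mem_of_primeUnit_of_integral [NoZeroDivisors (MonoidAlgebra (ZMod p) Γ)]
    (P : Subgroup (C0 p Γ)ˣ) (hprime : C0.primeUnit p Γ ∈ P)
    (hint : ∀ u : (C0.integral p Γ)ˣ, Units.map (C0.integral p Γ).subtype.toMonoidHom u ∈ P)
    (f : (C0 p Γ)ˣ) : f ∈ P := by
  obtain ⟨k, u, rfl⟩ := C0.exists_primeUnit_zpow_mul f
  exact P.mul_mem (P.zpow_mem hprime k) (hint u)

theorem isLogDetUnits_unique [NoZeroDivisors (MonoidAlgebra (ZMod p) Γ)]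
    {L : K1 (C0.integral p Γ) →* Multiplicative ℚ_[p]} {D D' : (C0 p Γ)ˣ →* Multiplicative ℚ_[p]}
    (hD : IsLogDetUnits p Γ L D) (hD' : IsLogDetUnits p Γ L D') : D = D' :=
  MonoidHom.ext <| mem_of_primeUnit_of_integral (D.eqLocus D')
    (Multiplicative.toAdd.injective
      ((hD.prime _ C0.primeUnit_val).trans (hD'.prime _ C0.primeUnit_val).symm))
    fun u => (hD.integral u).trans (hD'.integral u).symm

variable (S : ℕ → Subgroup Γ) [∀ n, (S n).Normal] [∀ n, (S n).FiniteIndex]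

/-- The embedding `c₀(Γ)ˣ = GL_1(c₀(Γ))`. -/
noncomputable def unitsToGLOne (p : ℕ) [Fact p.Prime] (Γ : Type*) [Group Γ] :
    (C0 p Γ)ˣ →* (Matrix (Fin 1) (Fin 1) (C0 p Γ))ˣ :=
  Units.map (Matrix.scalar (Fin 1)).toMonoidHom

theorem unitsToGLOne_val (f : (C0 p Γ)ˣ) :
    (unitsToGLOne p Γ f).val = Matrix.of fun _ _ : Fin 1 => (f : C0 p Γ) := by
  refine Matrix.ext fun i j => ?_
  obtain rfl := Subsingleton.elim i j
  simp [unitsToGLOne]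

/-- The determinant of `p` on the quotient is a power of `p`, and `log_p p = 0` for the chosen
branch. -/
theorem logDetSeq_primeUnit : logDetSeq S p 1 (unitsToGLOne p Γ (C0.primeUnit p Γ)) = 1 := by
  refine Multiplicative.toAdd.injective (funext fun n => ?_)
  have h1 : (unitsToGLOne p Γ (C0.primeUnit p Γ)).val =
      (p : ℚ_[p]) • (1 : Matrix (Fin 1) (Fin 1) (C0 p Γ)) := by
    rw [unitsToGLOne_val, C0.primeUnit_val, C0.natCast_eq_smul_one]
    refine Matrix.ext fun i j => ?_
    obtain rfl := Subsingleton.elim i j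
    simp
  have hp0 : (p : ℚ_[p]) ≠ 0 := Nat.cast_ne_zero.mpr hp.out.ne_zero
  rw [logDetSeq_apply, h1, C0.detRho_eq, C0.matRep_smul, map_one, Matrix.det_smul, Matrix.det_one, mul_one,
    padicLog_pow hp0, padicLog_prime, mul_zero, mul_zero]
  rfl

theorem exists_isLogDetUnits [NoZeroDivisors (MonoidAlgebra (ZMod p) Γ)]
    {L : K1 (C0.integral p Γ) →* Multiplicative ℚ_[p]}
    (hL : ∀ (r : ℕ) (f : (Matrix (Fin r) (Fin r) (C0.integral p Γ))ˣ),
      IsLogDetLimit S (glVal f) (logDetGL L f)) :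
    ∃ D, IsLogDetUnits p Γ L D ∧ ∀ f : (C0 p Γ)ˣ,
      IsLogDetLimit S (Matrix.of fun _ _ : Fin 1 => (f : C0 p Γ)) (D f).toAdd := by
  set s := (logDetSeq S p 1).comp (unitsToGLOne p Γ) with hs
  have hint : ∀ u : (C0.integral p Γ)ˣ,
      Tendsto (s (Units.map (C0.integral p Γ).subtype.toMonoidHom u)).toAdd atTop
        (𝓝 (L (unitsToK1 _ u)).toAdd) := fun u => by
    have h := (hL 1 (Units.map (Matrix.scalar (Fin 1)).toMonoidHom u)).2
    have h1 : glVal (Units.map (Matrix.scalar (Fin 1)).toMonoidHom u) =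
        (unitsToGLOne p Γ (Units.map (C0.integral p Γ).subtype.toMonoidHom u)).val := by
      rw [unitsToGLOne_val]
      refine Matrix.ext fun i j => ?_
      obtain rfl := Subsingleton.elim i j
      simp [glVal]
    rw [h1] at h
    exact h
  have hprime : s (C0.primeUnit p Γ) = 1 := logDetSeq_primeUnit S
  obtain ⟨D, hD⟩ := exists_limit_hom s (mem_of_primeUnit_of_integral _
    ⟨0, by
      rw [hprime]
      exact tendsto_const_nhds⟩
    fun u => ⟨_, hint u⟩)
  refine ⟨D, ⟨fun u => ?_, fun u hu => ?_⟩, fun f => ?_⟩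
  · exact Multiplicative.toAdd.injective (tendsto_nhds_unique (hD _) (hint u))
  · have : u = C0.primeUnit p Γ := Units.ext (hu.trans C0.primeUnit_val.symm)
    subst this
    have h := hD (C0.primeUnit p Γ)
    rw [hprime] at h
    exact tendsto_nhds_unique h tendsto_const_nhds
  · rw [← unitsToGLOne_val]
    exact (isLogDetLimit_iff S _ _).mpr (hD f)

end Units

/-! ### The limit formula in the three cases -/

theorem proposition5p7 (p : ℕ) [Fact p.Prime] (Γ : Type*) [Group Γ] [Countable Γ]
    [Group.ResiduallyFinite Γ]
    (S : ℕ → Subgroup Γ) [∀ n, (S n).Normal] [∀ n, (S n).FiniteIndex]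
    (hS : ∀ γ : Γ, γ ≠ 1 → {n : ℕ | γ ∈ S n}.Finite) :
    (∀ (r : ℕ) (f : Matrix (Fin r) (Fin r) (C0 p Γ)), IsOneUnit f →
      IsLogDetLimit S f (logDetOneUnit f)) ∧
    (IsMulTorsion (WhiteheadGroup (ZMod p) Γ) →
      (∃! L, IsLogDetK1 p Γ L) ∧
      ∀ L, IsLogDetK1 p Γ L →
        (∀ (r : ℕ) (f : (Matrix (Fin r) (Fin r) (C0.integral p Γ))ˣ),
          IsLogDetLimit S (glVal f) (logDetGL L f)) ∧
        (NoZeroDivisors (MonoidAlgebra (ZMod p) Γ) →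
          (∃! D, IsLogDetUnits p Γ L D) ∧
          ∀ D, IsLogDetUnits p Γ L D → ∀ f : (C0 p Γ)ˣ,
            IsLogDetLimit S (Matrix.of fun _ _ : Fin 1 => (f : C0 p Γ)) (D f).toAdd)) := by
  refine ⟨fun r f hf => isLogDetLimit_oneUnit hS hf, fun hWh => ?_⟩
  obtain ⟨L, hL, hlim⟩ := exists_isLogDetK1 S hS hWh
  refine ⟨⟨L, hL, fun L' hL' => isLogDetK1_unique hWh hL' hL⟩, fun L' hL' => ?_⟩
  -- By uniqueness, an arbitrary `L'` is the homomorphism constructed as a limit, so it inherits the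
  -- limit formula.
  obtain rfl := isLogDetK1_unique hWh hL hL'
  refine ⟨hlim, fun hdom => ?_⟩
  obtain ⟨D, hD, hDlim⟩ := exists_isLogDetUnits S hlim
  refine ⟨⟨D, hD, fun D' hD' => isLogDetUnits_unique hD' hD⟩, fun D' hD' => ?_⟩
  obtain rfl := isLogDetUnits_unique hD hD'
  exact hDlim
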